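/- Let $N=(N(t))_{t\ge 0}$ be an orderly counting process on a probability space: its paths are non-negative integer-valued, finite, nondecreasing and right-continuous with left-hand limits, and $N(t)-N(t-)\le 1$ for all $t\ge 0$, where $N(0-)=0$. Put $t_{n-1}=\inf\{t\ge 0: n\le N(t)\}$ (with $\inf\emptyset=\infty$) for $n\ge 1$, $T_0=t_0$, $T_n=t_n-t_{n-1}$ for $n\ge 1$, and $$R(t)=T_0+\sum_{\ell=1}^{N(t)}T_\ell-t,\qquad X(t)=(N(t),R(t)),\qquad t\ge 0 .$$ Let $(\mathcal F_t)_{t\ge 0}$ be a filtration with $\sigma(X(u);u\le t)\subset\mathcal F_t$ for all $t\ge0$, and put $\mathcal F_{\tau-}=\sigma(A\cap\{t<\tau\};\,A\in\mathcal F_t,\ t\ge 0)$. Assume: - (A.1) $X(0)=(1,T_1)$ almost surely; - (A.2) $\mathbb E[T_n]<\infty$ for all $n\ge 1$; - (A.3) for every $n\ge1$, $T_n$ is independent of $\mathcal F_{t_{n-1}-}$, and $T_1,T_2,\dots$ are identically distributed; let $T$ denote a random variable with their common distribution, $\lambda=1/\mathbb E[T]$ and $\sigma_T^2=\operatorname{Var}(T)$;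 - $\mathbb E[T^3]<\infty$; - (4a) the function $t\mapsto \mathbb E[R(t)]-\tfrac12\lambda\,\mathbb E[T^2]$ is directly Riemann integrable on $[0,\infty)$, i.e. for every mesh $h>0$ its upper and lower Riemann sums over the cells $[nh,(n+1)h)$, $n\ge0$, converge absolutely, and the difference of the two sums tends to $0$ as $h\downarrow0$. Let $M(t)=\sum_{n=1}^{N(t)}(1-\lambda T_n)$. Then $R(t)M(t)$ is integrable for every $t\ge 0$ and $$\lim_{t\to\infty}\mathbb E[R(t)M(t)]=\tfrac12\big(\lambda\,\mathbb E[T^2]-\lambda^2\,\mathbb E[T^3]\big)+\tfrac12\lambda^3\sigma_T^2\,\mathbb E[T^2].$$ -/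

import Mathlib

open MeasureTheory ProbabilityTheory Filter Topology Set
open scoped NNReal ENNReal

noncomputable section

namespace Renewal

/-- The paths of `N` are finite, integer-valued, nondecreasing and right-continuous with left-hand
limits, and all jumps have size at most one, where `N(0-) = 0`. -/
structure IsOrderlyCounting {Ω : Type*} (N : ℝ≥0 → Ω → ℕ) : Prop where
  mono : ∀ ω, Monotone fun t => N t ω
  rightCts : ∀ ω t, ContinuousWithinAt (fun s => N s ω) (Ici t) t
  jump : ∀ ω t, 0 < t →
    ∃ l : ℕ, Tendsto (fun s => N s ω) (𝓝[<] t) (𝓝 l) ∧ N t ω ≤ l + 1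
  jump_zero : ∀ ω, N 0 ω ≤ 1

/-- The counting time `t_n = inf {t ≥ 0 ; n + 1 ≤ N(t)}`, equal to `∞` if there is no such `t`. -/
def countingTime {Ω : Type*} (N : ℝ≥0 → Ω → ℕ) (n : ℕ) (ω : Ω) : ℝ≥0∞ :=
  ⨅ (t : ℝ≥0) (_ : n + 1 ≤ N t ω), (t : ℝ≥0∞)

/-- `T_0 = t_0` and `T_n = t_n - t_{n-1}` for `n ≥ 1`, with values in `[0, ∞]`. -/
def interTime {Ω : Type*} (N : ℝ≥0 → Ω → ℕ) : ℕ → Ω → ℝ≥0∞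
  | 0, ω => countingTime N 0 ω
  | n + 1, ω => countingTime N (n + 1) ω - countingTime N n ω

/-- The residual time `R(t) = T_0 + ∑_{ℓ=1}^{N(t)} T_ℓ - t`. (As soon as all the `T_ℓ` have finite
mean, the sum is finite almost surely.) -/
def residual {Ω : Type*} (N : ℝ≥0 → Ω → ℕ) (t : ℝ≥0) (ω : Ω) : ℝ :=
  (interTime N 0 ω + ∑ l ∈ Finset.Icc 1 (N t ω), interTime N l ω).toReal - (t : ℝ)

/-- The process `X(t) = (N(t), R(t))`. -/
def stateProcess {Ω : Type*} (N : ℝ≥0 → Ω → ℕ) (t : ℝ≥0) (ω : Ω) : ℕ × ℝ :=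
  (N t ω, residual N t ω)

/-- The sigma-field `σ(X(u) ; u ≤ t)`. -/
@[reducible] def stateSigma {Ω : Type*} (N : ℝ≥0 → Ω → ℕ) (t : ℝ≥0) : MeasurableSpace Ω :=
  ⨆ (u : ℝ≥0) (_ : u ≤ t), MeasurableSpace.comap (stateProcess N u) inferInstance

/-- The sigma-field `F_{τ-} = σ(A ∩ {t < τ} ; A ∈ F_t, t ≥ 0)` of events strictly before `τ`. -/
@[reducible] def strictPast {Ω : Type*} {mΩ : MeasurableSpace Ω} (F : Filtration ℝ≥0 mΩ) (τ : Ω → ℝ≥0∞) :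
    MeasurableSpace Ω :=
  MeasurableSpace.generateFrom
    {B | ∃ (t : ℝ≥0) (A : Set Ω), MeasurableSet[F t] A ∧ B = A ∩ {ω | (t : ℝ≥0∞) < τ ω}}

/-- Assumption (A.1): `X(0) = (1, T_1)` almost surely, i.e. the process is non-delayed. -/
def StartsAtZero {Ω : Type*} [MeasurableSpace Ω] (μ : Measure Ω) (N : ℝ≥0 → Ω → ℕ) : Prop :=
  ∀ᵐ ω ∂μ, stateProcess N 0 ω = (1, (interTime N 1 ω).toReal)

/-- Assumption (A.2): `E[T_n] < ∞` for all `n ≥ 1`. In particular each `T_n` is finite almost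
surely; its positivity is a consequence of orderliness. -/
def FiniteMeans {Ω : Type*} [MeasurableSpace Ω] (μ : Measure Ω) (N : ℝ≥0 → Ω → ℕ) : Prop :=
  ∀ n, 1 ≤ n → ∫⁻ ω, interTime N n ω ∂μ < ∞

/-- Assumption (A.3): for `n ≥ 1`, `T_n` is independent of `F_{t_{n-1}-}`, and `T_1, T_2, …` are
identically distributed. -/
structure RenewalCondition {Ω : Type*} {mΩ : MeasurableSpace Ω} (μ : Measure Ω)
    (F : Filtration ℝ≥0 mΩ) (N : ℝ≥0 → Ω → ℕ) : Prop where
  indep : ∀ n, Indep (MeasurableSpace.comap (interTime N (n + 1)) inferInstance)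
    (strictPast F (countingTime N n)) μ
  identDistrib : ∀ n, 1 ≤ n → IdentDistrib (interTime N n) (interTime N 1) μ μ

/-- A generic lifetime `T` as a real random variable. -/
def lifetime {Ω : Type*} (N : ℝ≥0 → Ω → ℕ) (ω : Ω) : ℝ :=
  (interTime N 1 ω).toReal

/-- `λ = 1 / E[T]`. -/
def rate {Ω : Type*} [MeasurableSpace Ω] (μ : Measure Ω) (N : ℝ≥0 → Ω → ℕ) : ℝ :=
  1 / ∫ ω, lifetime N ω ∂μ

/-- `M(t) = ∑_{n=1}^{N(t)} (1 - λ T_n)`. -/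
def renewalMartingale {Ω : Type*} [MeasurableSpace Ω] (μ : Measure Ω) (N : ℝ≥0 → Ω → ℕ)
    (t : ℝ≥0) (ω : Ω) : ℝ :=
  ∑ n ∈ Finset.Icc 1 (N t ω), (1 - rate μ N * (interTime N n ω).toReal)

/-- The cell `[n h, (n + 1) h)`. -/
def cell (h : ℝ≥0) (n : ℕ) : Set ℝ≥0 := Ico (n * h) ((n + 1) * h)

/-- Direct Riemann integrability on `[0, ∞)` of a function of arbitrary sign: for every mesh `h > 0`
the upper and lower Riemann sums over the whole half-line are (absolutely) convergent, and their
difference vanishes as `h ↓ 0`. -/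
structure DirectlyRiemannIntegrable (f : ℝ≥0 → ℝ) : Prop where
  bddAbove : ∀ h, 0 < h → ∀ n, BddAbove (f '' cell h n)
  bddBelow : ∀ h, 0 < h → ∀ n, BddBelow (f '' cell h n)
  summable_sup : ∀ h, 0 < h → Summable fun n => sSup (f '' cell h n)
  summable_inf : ∀ h, 0 < h → Summable fun n => sInf (f '' cell h n)
  tendsto : Tendsto
    (fun h : ℝ≥0 => (h : ℝ) * ∑' n, sSup (f '' cell h n) - (h : ℝ) * ∑' n, sInf (f '' cell h n))
    (𝓝[>] 0) (𝓝 0)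

end Renewal

end

set_option linter.unusedSectionVars false

/-! Let `U` be the sum of the laws of S_n = T_1 + ... + T_n, n ≥ 0, so that U[0,t] = E[N(t)]. Put c
= λE[T²]/2 and g(t) = E[R(t)] - c for t ≥ 0, g = 0 on the negative half-line. Wald's identity reads
U[0,t] E[T] = t + E[R(t)], hence U[0,t] = λ(t + c + g(t)). By (4a), g is directly Riemann integrable
and therefore vanishes at infinity, so Blackwell's theorem for `U` is immediate
(`isBlackwell_of_asymptotics`), with no separate non-lattice hypothesis. The key renewal theorem
follows from it (`StepSandwiched.tendsto_integral`). Since ∑ T_n = R(t) + t, M(t) is the difference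
of the sums ∑ w(T_n) for w = 1 and w(x) = x, the latter multiplied by λ. Splitting over the interval
that straddles t, `lintegral_weights_mul_overshoot` gives E[R(t) ∑ w(T_n)] = (U ⋆ k_w)(t) + ∫ w(x)
(U ⋆ r)(t - x) ν(dx), where k_w(u) = E[w(T)(T - u)⁺], r(t) = E[R(t)] = (U ⋆ k_1)(t) and ν is the law
of T. Substituting r = c + g leaves one divergent term c E[w] U[0,t], and the remainder tends to
λE[w(T)T²]/2 + λE[w]∫g - cλE[w(T)T] (`tendsto_weights`). In the difference both the divergent terms
and the unknown ∫g cancel because λE[T] = 1. What remains is (λE[T²] - λ²E[T³])/2 + c(λ²E[T²] - 1),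
and λ²E[T²] - 1 = λ²σ_T². -/

namespace Renewal

/-! ### Step functions with summable values -/

/-- The step function on `[0, ∞)` with value `a n` on `[n h, (n + 1) h)`, extended by zero. -/
noncomputable def stepFun (h : ℝ) (a : ℕ → ℝ) (x : ℝ) : ℝ := if 0 ≤ x then a ⌊x / h⌋₊ else 0

lemma mem_Ico_iff_floor {h : ℝ} (hh : 0 < h) (n : ℕ) (x : ℝ) :
    x ∈ Ico (n * h) ((n + 1) * h) ↔ 0 ≤ x ∧ ⌊x / h⌋₊ = n := by
  constructor
  · rintro ⟨h1, h2⟩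
    have hx : 0 ≤ x := le_trans (by positivity) h1
    refine ⟨hx, ?_⟩
    rw [Nat.floor_eq_iff (by positivity)]
    exact ⟨(le_div_iff₀ hh).2 h1, (div_lt_iff₀ hh).2 h2⟩
  · rintro ⟨hx, h1⟩
    rw [Nat.floor_eq_iff (by positivity)] at h1
    exact ⟨(le_div_iff₀ hh).1 h1.1, (div_lt_iff₀ hh).1 h1.2⟩

lemma hasSum_stepFun {h : ℝ} (hh : 0 < h) (a : ℕ → ℝ) (x : ℝ) :
    HasSum (fun n : ℕ => (Ico (n * h) ((n + 1) * h)).indicator (fun _ => a n) x)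
      (stepFun h a x) := by
  by_cases hx : 0 ≤ x
  · have := hasSum_single (f := fun n : ℕ =>
      (Ico (n * h) ((n + 1) * h)).indicator (fun _ => a n) x) ⌊x / h⌋₊ (by
        intro n hn
        refine indicator_of_notMem (fun hm => hn ?_) _
        exact ((mem_Ico_iff_floor hh n x).1 hm).2.symm)
    rw [indicator_of_mem ((mem_Ico_iff_floor hh _ x).2 ⟨hx, rfl⟩)] at this
    simpa [stepFun, hx] using this
  · have h0 : ∀ n : ℕ, (Ico (n * h) ((n + 1) * h)).indicator (fun _ => a n) x = 0 := fun n =>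
      indicator_of_notMem (fun hm => hx ((mem_Ico_iff_floor hh n x).1 hm).1) _
    simp only [h0, stepFun, hx, if_false]
    exact hasSum_zero

lemma measurable_stepFun (h : ℝ) (a : ℕ → ℝ) : Measurable (stepFun h a) := by
  unfold stepFun
  refine Measurable.ite measurableSet_Ici ?_ measurable_const
  exact (measurable_of_countable a).comp (Nat.measurable_floor.comp (measurable_id.div_const h))

section

variable {m : Measure ℝ} {h C : ℝ} {a : ℕ → ℝ}

/-- The uniform bound `C` on the mass of a cell makes the sum of |a n| times the cell masses
converge, so sum and integral commute. The measure is left general to cover both Lebesgue measure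
and the renewal measure reflected at t. -/
lemma integral_stepFun_aux (hh : 0 < h) (ha : Summable a)
    (hfin : ∀ n : ℕ, m (Ico (n * h) ((n + 1) * h)) ≠ ∞)
    (hC : ∀ n : ℕ, m.real (Ico (n * h) ((n + 1) * h)) ≤ C) :
    HasSum (fun n : ℕ => a n * m.real (Ico (n * h) ((n + 1) * h))) (∫ x, stepFun h a x ∂m) ∧
      Integrable (stepFun h a) m := by
  have hint : ∀ n : ℕ, Integrable
      ((Ico (n * h) ((n + 1) * h)).indicator (fun _ => a n)) m := fun n =>
    (integrable_indicator_iff measurableSet_Ico).2 (integrableOn_const (hfin n))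
  have hnorm : ∀ n : ℕ, ∫ x, ‖(Ico (n * h) ((n + 1) * h)).indicator (fun _ => a n) x‖ ∂m
      = m.real (Ico (n * h) ((n + 1) * h)) * |a n| := fun n => by
    simp only [norm_indicator_eq_indicator_norm]
    rw [integral_indicator measurableSet_Ico]
    simp
  have hsum : Summable fun n : ℕ =>
      ∫ x, ‖(Ico (n * h) ((n + 1) * h)).indicator (fun _ => a n) x‖ ∂m := by
    simp only [hnorm]
    refine Summable.of_nonneg_of_le (fun n => by positivity) (fun n => ?_) (ha.abs.mul_left C)
    exact mul_le_mul_of_nonneg_right (hC n) (abs_nonneg _)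
  have heq : stepFun h a = fun x => ∑' n : ℕ,
      (Ico (n * h) ((n + 1) * h)).indicator (fun _ => a n) x :=
    funext fun x => (hasSum_stepFun hh a x).tsum_eq.symm
  refine ⟨?_, ?_⟩
  · have := hasSum_integral_of_summable_integral_norm hint hsum
    rw [heq]
    have hI : ∀ n : ℕ, ∫ x, (Ico (n * h) ((n + 1) * h)).indicator (fun _ => a n) x ∂m
        = a n * m.real (Ico (n * h) ((n + 1) * h)) := fun n => by
      rw [integral_indicator measurableSet_Ico]
      simp [mul_comm]
    simpa only [hI] using this
  · refine ⟨(measurable_stepFun h a).aestronglyMeasurable, ?_⟩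
    rw [HasFiniteIntegral]
    calc ∫⁻ x, ‖stepFun h a x‖ₑ ∂m
        ≤ ∫⁻ x, ∑' n : ℕ, ‖(Ico (n * h) ((n + 1) * h)).indicator (fun _ => a n) x‖ₑ ∂m := by
          refine lintegral_mono fun x => ?_
          by_cases hx : 0 ≤ x
          · refine le_trans ?_ (ENNReal.le_tsum ⌊x / h⌋₊)
            rw [indicator_of_mem ((mem_Ico_iff_floor hh _ x).2 ⟨hx, rfl⟩)]
            simp [stepFun, hx]
          · simp [stepFun, hx]
      _ = ∑' n : ℕ, ∫⁻ x, ‖(Ico (n * h) ((n + 1) * h)).indicator (fun _ => a n) x‖ₑ ∂m :=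
          lintegral_tsum fun n => (hint n).1.enorm
      _ = ∑' n : ℕ, ENNReal.ofReal
            (∫ x, ‖(Ico (n * h) ((n + 1) * h)).indicator (fun _ => a n) x‖ ∂m) := by
          refine tsum_congr fun n => ?_
          rw [ofReal_integral_norm_eq_lintegral_enorm (hint n)]
      _ < ∞ := hsum.tsum_ofReal_lt_top

lemma hasSum_integral_stepFun (hh : 0 < h) (ha : Summable a)
    (hfin : ∀ n : ℕ, m (Ico (n * h) ((n + 1) * h)) ≠ ∞)
    (hC : ∀ n : ℕ, m.real (Ico (n * h) ((n + 1) * h)) ≤ C) :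
    HasSum (fun n : ℕ => a n * m.real (Ico (n * h) ((n + 1) * h))) (∫ x, stepFun h a x ∂m) :=
  (integral_stepFun_aux hh ha hfin hC).1

lemma integrable_stepFun (hh : 0 < h) (ha : Summable a)
    (hfin : ∀ n : ℕ, m (Ico (n * h) ((n + 1) * h)) ≠ ∞)
    (hC : ∀ n : ℕ, m.real (Ico (n * h) ((n + 1) * h)) ≤ C) :
    Integrable (stepFun h a) m :=
  (integral_stepFun_aux hh ha hfin hC).2

end

lemma volume_real_cell {h : ℝ} (hh : 0 < h) (n : ℕ) :
    (volume : Measure ℝ).real (Ico (n * h) ((n + 1) * h)) = h := by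
  rw [Real.volume_real_Ico_of_le (by nlinarith)]; ring

lemma integrable_stepFun_volume {h : ℝ} (hh : 0 < h) {a : ℕ → ℝ} (ha : Summable a) :
    Integrable (stepFun h a) :=
  integrable_stepFun (C := h) hh ha (fun n => by simp) fun n => (volume_real_cell hh n).le

lemma integral_stepFun_volume {h : ℝ} (hh : 0 < h) {a : ℕ → ℝ} (ha : Summable a) :
    ∫ x, stepFun h a x = h * ∑' n, a n := by
  have := hasSum_integral_stepFun (m := volume) (C := h) hh ha (fun n => by simp)
    fun n => (volume_real_cell hh n).le
  simp only [volume_real_cell hh] at this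
  rw [← this.tsum_eq, tsum_mul_right, mul_comm]

/-! ### From Blackwell's theorem to the key renewal theorem -/

/-- `f` lies between step functions of summable values whose integrals are arbitrarily close. -/
def StepSandwiched (f : ℝ → ℝ) : Prop :=
  ∀ ε > 0, ∃ h > 0, ∃ a b : ℕ → ℝ, Summable a ∧ Summable b ∧
    (∀ x, stepFun h b x ≤ f x) ∧ (∀ x, f x ≤ stepFun h a x) ∧ h * ∑' n, a n - h * ∑' n, b n < ε

/-- The conclusion of Blackwell's theorem, with local finiteness and a uniform bound. -/
structure IsBlackwell (U : Measure ℝ) (lam : ℝ) : Prop where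
  finite : ∀ t, U (Iic t) ≠ ∞
  bound : ∀ h, 0 < h → ∃ C, ∀ t, U.real (Ioc (t - h) t) ≤ C
  tendsto : ∀ h, 0 < h → Tendsto (fun t => U.real (Ioc (t - h) t)) atTop (𝓝 (lam * h))

namespace IsBlackwell

variable {U : Measure ℝ} {lam : ℝ}

lemma map_cell (t h : ℝ) (n : ℕ) :
    (U.map fun s => t - s) (Ico (n * h) ((n + 1) * h)) = U (Ioc (t - n * h - h) (t - n * h)) := by
  rw [Measure.map_apply (by fun_prop) measurableSet_Ico]
  congr 1
  ext s
  simp only [mem_preimage, mem_Ico, mem_Ioc]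
  constructor <;> rintro ⟨h1, h2⟩ <;> constructor <;> linarith

lemma finite_Ioc (hU : IsBlackwell U lam) (s t : ℝ) : U (Ioc s t) ≠ ∞ :=
  ne_top_of_le_ne_top (hU.finite t) (measure_mono fun _ hx => hx.2)

lemma integrable_step (hU : IsBlackwell U lam) {h : ℝ} (hh : 0 < h) {a : ℕ → ℝ}
    (ha : Summable a) (t : ℝ) : Integrable (fun s => stepFun h a (t - s)) U := by
  obtain ⟨C, hC⟩ := hU.bound h hh
  have := integrable_stepFun (m := U.map fun s => t - s) (C := C) hh ha
    (fun n => by rw [map_cell]; exact hU.finite_Ioc _ _)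
    (fun n => by rw [measureReal_def, map_cell]; exact hC _)
  exact (integrable_map_measure (measurable_stepFun h a).aestronglyMeasurable
    (by fun_prop)).1 this

lemma hasSum_integral_step (hU : IsBlackwell U lam) {h : ℝ} (hh : 0 < h) {a : ℕ → ℝ}
    (ha : Summable a) (t : ℝ) :
    HasSum (fun n : ℕ => a n * U.real (Ioc (t - n * h - h) (t - n * h)))
      (∫ s, stepFun h a (t - s) ∂U) := by
  obtain ⟨C, hC⟩ := hU.bound h hh
  have := hasSum_integral_stepFun (m := U.map fun s => t - s) (C := C) hh ha
    (fun n => by rw [map_cell]; exact hU.finite_Ioc _ _)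
    (fun n => by rw [measureReal_def, map_cell]; exact hC _)
  simp only [measureReal_def, map_cell] at this
  rwa [integral_map (by fun_prop) (measurable_stepFun h a).aestronglyMeasurable] at this

lemma bound_integral_step (hU : IsBlackwell U lam) {h : ℝ} (hh : 0 < h) {a : ℕ → ℝ}
    (ha : Summable a) : ∃ B, ∀ t, |∫ s, stepFun h a (t - s) ∂U| ≤ B := by
  obtain ⟨C, hC⟩ := hU.bound h hh
  refine ⟨∑' n, |a n| * C, fun t => ?_⟩
  rw [← (hU.hasSum_integral_step hh ha t).tsum_eq, ← Real.norm_eq_abs]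
  refine tsum_of_norm_bounded (ha.abs.mul_right C).hasSum fun n => ?_
  rw [norm_mul, Real.norm_eq_abs, Real.norm_eq_abs, abs_of_nonneg measureReal_nonneg]
  exact mul_le_mul_of_nonneg_left (hC _) (abs_nonneg _)

/-- Blackwell's theorem gives the limit of the mass of each reflected cell; the uniform bound on
these masses allows dominated convergence in the sum over cells. -/
lemma tendsto_integral_step (hU : IsBlackwell U lam) {h : ℝ} (hh : 0 < h) {a : ℕ → ℝ}
    (ha : Summable a) :
    Tendsto (fun t => ∫ s, stepFun h a (t - s) ∂U) atTop (𝓝 (lam * (h * ∑' n, a n))) := by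
  obtain ⟨C, hC⟩ := hU.bound h hh
  have key : Tendsto (fun t : ℝ => ∑' n : ℕ, a n * U.real (Ioc (t - n * h - h) (t - n * h)))
      atTop (𝓝 (∑' n, a n * (lam * h))) := by
    refine tendsto_tsum_of_dominated_convergence (bound := fun n => |a n| * C)
      (ha.abs.mul_right C) (fun n => ?_) (Eventually.of_forall fun t n => ?_)
    · refine Tendsto.const_mul _ ?_
      have : Tendsto (fun t : ℝ => t - n * h) atTop atTop :=
        tendsto_atTop_add_const_right _ _ tendsto_id
      exact (hU.tendsto h hh).comp this
    · rw [norm_mul, Real.norm_eq_abs, Real.norm_eq_abs, abs_of_nonneg measureReal_nonneg]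
      exact mul_le_mul_of_nonneg_left (hC _) (abs_nonneg _)
  rw [tsum_mul_right] at key
  convert key using 2 with t
  · exact (hU.hasSum_integral_step hh ha t).tsum_eq.symm
  · ring

end IsBlackwell

section KeyRenewal

variable {f : ℝ → ℝ}

lemma StepSandwiched.exists_abs_le (hf : StepSandwiched f) :
    ∃ h > 0, ∃ a : ℕ → ℝ, Summable a ∧ ∀ x, |f x| ≤ stepFun h a x := by
  obtain ⟨h, hh, a, b, ha, hb, hbf, hfa, -⟩ := hf 1 one_pos
  refine ⟨h, hh, fun n => |a n| + |b n|, ha.abs.add hb.abs, fun x => ?_⟩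
  have h1 := hbf x
  have h2 := hfa x
  unfold stepFun at *
  split_ifs at * with hx
  · rw [abs_le]
    constructor
    · linarith [neg_abs_le (b ⌊x / h⌋₊), abs_nonneg (a ⌊x / h⌋₊)]
    · linarith [le_abs_self (a ⌊x / h⌋₊), abs_nonneg (b ⌊x / h⌋₊)]
  · rw [abs_le]; constructor <;> linarith

lemma StepSandwiched.integrable_volume (hf : StepSandwiched f) (hm : Measurable f) :
    Integrable f := by
  obtain ⟨h, hh, a, ha, hfa⟩ := hf.exists_abs_le
  exact (integrable_stepFun_volume hh ha).mono' hm.aestronglyMeasurable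
    (Eventually.of_forall hfa)

variable {U : Measure ℝ} {lam : ℝ}

lemma StepSandwiched.integrable (hf : StepSandwiched f) (hm : Measurable f)
    (hU : IsBlackwell U lam) (t : ℝ) : Integrable (fun s => f (t - s)) U := by
  obtain ⟨h, hh, a, ha, hfa⟩ := hf.exists_abs_le
  exact (hU.integrable_step hh ha t).mono' (hm.comp (by fun_prop)).aestronglyMeasurable
    (Eventually.of_forall fun s => hfa _)

/-- Uniformity in t is the point: it supplies the dominating function when this convolution is
integrated against a weight in `tendsto_weights`. -/
lemma StepSandwiched.bound_integral (hf : StepSandwiched f) (hm : Measurable f)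
    (hU : IsBlackwell U lam) : ∃ B, ∀ t, |∫ s, f (t - s) ∂U| ≤ B := by
  obtain ⟨h, hh, a, ha, hfa⟩ := hf.exists_abs_le
  obtain ⟨B, hB⟩ := hU.bound_integral_step hh ha
  refine ⟨B, fun t => ?_⟩
  calc |∫ s, f (t - s) ∂U| ≤ ∫ s, |f (t - s)| ∂U := abs_integral_le_integral_abs
    _ ≤ ∫ s, stepFun h a (t - s) ∂U :=
        integral_mono (hf.integrable hm hU t).abs (hU.integrable_step hh ha t) fun s => hfa _
    _ ≤ B := (le_abs_self _).trans (hB t)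

/-- The key renewal theorem, for a measure satisfying Blackwell's theorem. -/
theorem StepSandwiched.tendsto_integral (hf : StepSandwiched f) (hm : Measurable f)
    (hU : IsBlackwell U lam) (hlam : 0 < lam) :
    Tendsto (fun t => ∫ s, f (t - s) ∂U) atTop (𝓝 (lam * ∫ x, f x)) := by
  rw [Metric.tendsto_nhds]
  intro ε hε
  -- Half of ε pays for the gap between the two step integrals after multiplication by `lam`, the
  -- other half for their convergence.
  obtain ⟨h, hh, a, b, ha, hb, hbf, hfa, hab⟩ := hf (ε / (2 * lam)) (by positivity)
  have hfi := hf.integrable_volume hm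
  have hlo : h * ∑' n, b n ≤ ∫ x, f x := by
    rw [← integral_stepFun_volume hh hb]
    exact integral_mono (integrable_stepFun_volume hh hb) hfi hbf
  have hup : ∫ x, f x ≤ h * ∑' n, a n := by
    rw [← integral_stepFun_volume hh ha]
    exact integral_mono hfi (integrable_stepFun_volume hh ha) hfa
  have hab' : lam * (h * ∑' n, a n) - lam * (h * ∑' n, b n) < ε / 2 := by
    have := mul_lt_mul_of_pos_left hab hlam
    rw [mul_sub] at this
    refine this.trans_le (le_of_eq ?_)
    field_simp
  have hlo' := mul_le_mul_of_nonneg_left hlo hlam.le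
  have hup' := mul_le_mul_of_nonneg_left hup hlam.le
  filter_upwards [Metric.tendsto_nhds.1 (hU.tendsto_integral_step hh ha) (ε / 2) (by positivity),
    Metric.tendsto_nhds.1 (hU.tendsto_integral_step hh hb) (ε / 2) (by positivity)] with t h1 h2
  have h3 : ∫ s, stepFun h b (t - s) ∂U ≤ ∫ s, f (t - s) ∂U :=
    integral_mono (hU.integrable_step hh hb t) (hf.integrable hm hU t) fun s => hbf _
  have h4 : ∫ s, f (t - s) ∂U ≤ ∫ s, stepFun h a (t - s) ∂U :=
    integral_mono (hf.integrable hm hU t) (hU.integrable_step hh ha t) fun s => hfa _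
  rw [Real.dist_eq, abs_lt] at h1 h2 ⊢
  constructor <;> linarith [h1.1, h1.2, h2.1, h2.2]

/-- A monotone function is sandwiched by its values at the left and right ends of each cell. The two
sums telescope against each other, with gap h f(0). -/
lemma stepSandwiched_of_antitoneOn (hneg : ∀ x < 0, f x = 0) (hpos : ∀ x, 0 ≤ f x)
    (hanti : AntitoneOn f (Ici 0)) (hint : Integrable f) : StepSandwiched f := by
  intro ε hε
  -- This gives h f(0) < ε; the added 1 covers f(0) = 0.
  set h : ℝ := ε / (2 * (f 0 + 1)) with hdef
  have hf0 := hpos 0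
  have hh : 0 < h := by positivity
  have hle : ∀ x, stepFun h (fun n => f ((n + 1 : ℕ) * h)) x ≤ f x := fun x => by
    unfold stepFun
    split_ifs with hx
    · refine hanti hx (by simp only [mem_Ici]; positivity) ?_
      have := ((mem_Ico_iff_floor hh _ x).2 ⟨hx, rfl⟩).2
      push_cast
      exact this.le
    · exact hpos x
  have hge : ∀ x, f x ≤ stepFun h (fun n => f (n * h)) x := fun x => by
    unfold stepFun
    split_ifs with hx
    · refine hanti (by simp only [mem_Ici]; positivity) hx ?_
      exact ((mem_Ico_iff_floor hh _ x).2 ⟨hx, rfl⟩).1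
    · exact (hneg x (not_le.1 hx)).le
  -- The lower step function, truncated to finitely many cells, lies below `f`, so its integral
  -- bounds the partial sums.
  have hb : Summable fun n : ℕ => f ((n + 1 : ℕ) * h) := by
    refine summable_of_sum_range_le (c := (∫ x, f x) / h) (fun n => hpos _) fun k => ?_
    rw [le_div_iff₀ hh]
    set c : ℕ → ℝ := fun n => if n < k then f ((n + 1 : ℕ) * h) else 0 with hc
    have hcs : Summable c := summable_of_ne_finset_zero (s := Finset.range k) fun n hn => by
      simp [hc] at hn ⊢; omega
    have h1 : ∑' n, c n = ∑ n ∈ Finset.range k, f ((n + 1 : ℕ) * h) := by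
      rw [tsum_eq_sum (s := Finset.range k) fun n hn => by simp [hc] at hn ⊢; omega]
      exact Finset.sum_congr rfl fun n hn => by simp [hc, Finset.mem_range.1 hn]
    rw [← h1, mul_comm, ← integral_stepFun_volume hh hcs]
    refine integral_mono (integrable_stepFun_volume hh hcs) hint fun x => ?_
    refine le_trans ?_ (hle x)
    unfold stepFun
    split_ifs with hx
    · simp only [hc]
      split_ifs
      · exact le_rfl
      · exact hpos _
    · exact le_rfl
  have ha : Summable fun n : ℕ => f (n * h) := (summable_nat_add_iff 1).1 hb
  refine ⟨h, hh, fun n => f (n * h), fun n => f ((n + 1 : ℕ) * h), ha, hb, hle, hge, ?_⟩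
  rw [ha.tsum_eq_zero_add]
  simp only [Nat.cast_zero, zero_mul, mul_add, add_sub_cancel_right]
  rw [hdef, div_mul_eq_mul_div, div_lt_iff₀ (by positivity)]
  nlinarith

end KeyRenewal

/-! ### Renewal sequences and the renewal measure -/

/-- The partial sums `S_n = τ_0 + ⋯ + τ_{n-1}`. -/
def partialSum {Ω : Type*} (τ : ℕ → Ω → ℝ) (n : ℕ) (ω : Ω) : ℝ := ∑ i ∈ Finset.range n, τ i ω

/-- The `τ n` are positive with common law `ν`, each independent of its predecessors (in the form
needed for computing with the partial sums). -/
structure IsRenewalSequence {Ω : Type*} [MeasurableSpace Ω] (μ : Measure Ω) (ν : Measure ℝ)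
    (τ : ℕ → Ω → ℝ) : Prop where
  measurable : ∀ n, Measurable (τ n)
  map_eq : ∀ n, μ.map (τ n) = ν
  pos : ν (Iic 0) = 0
  indep_sum : ∀ m, IndepFun (partialSum τ m) (τ m) μ
  indep_pair : ∀ n m, n < m → IndepFun (fun ω => (τ n ω, partialSum τ m ω)) (τ m) μ

/-- The renewal measure, the sum of the laws of the partial sums. -/
noncomputable def renewalMeasure {Ω : Type*} [MeasurableSpace Ω] (μ : Measure Ω)
    (τ : ℕ → Ω → ℝ) : Measure ℝ :=
  Measure.sum fun n => μ.map (partialSum τ n)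

/-- The convolution `(U ⋆ f) t = ∫ f (t - s) U(ds)`. -/
noncomputable def lconv (U : Measure ℝ) (f : ℝ → ℝ≥0∞) (t : ℝ) : ℝ≥0∞ := ∫⁻ s, f (t - s) ∂U

/-- `u ↦ E[w(T) (T - u)⁺]` on `[0, ∞)`, extended by zero. -/
noncomputable def excess (ν : Measure ℝ) (w : ℝ → ℝ≥0∞) (u : ℝ) : ℝ≥0∞ :=
  if 0 ≤ u then ∫⁻ x, w x * ENNReal.ofReal (x - u) ∂ν else 0

/-- `u ↦ E[w(T); T > u]` on `[0, ∞)`, extended by zero. -/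
noncomputable def tail (ν : Measure ℝ) (w : ℝ → ℝ≥0∞) (u : ℝ) : ℝ≥0∞ :=
  if 0 ≤ u then ∫⁻ x, (if u < x then w x else 0) ∂ν else 0

lemma measurable_lconv {U : Measure ℝ} [SFinite U] {f : ℝ → ℝ≥0∞} (hf : Measurable f) :
    Measurable (lconv U f) :=
  Measurable.lintegral_prod_right' (f := fun p : ℝ × ℝ => f (p.1 - p.2)) (by fun_prop)

lemma measurable_excess {ν : Measure ℝ} [SFinite ν] {w : ℝ → ℝ≥0∞} (hw : Measurable w) :
    Measurable (excess ν w) :=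
  Measurable.ite measurableSet_Ici
    (Measurable.lintegral_prod_right' (f := fun p : ℝ × ℝ => w p.2 * ENNReal.ofReal (p.2 - p.1))
      (by fun_prop)) measurable_const

lemma measurable_tail {ν : Measure ℝ} [SFinite ν] {w : ℝ → ℝ≥0∞} (hw : Measurable w) :
    Measurable (tail ν w) :=
  Measurable.ite measurableSet_Ici
    (Measurable.lintegral_prod_right' (f := fun p : ℝ × ℝ => if p.1 < p.2 then w p.2 else 0)
      (Measurable.ite (measurableSet_lt measurable_fst measurable_snd) (by fun_prop)
        measurable_const)) measurable_const

lemma lintegral_of_indepFun {Ω α : Type*} [MeasurableSpace Ω] [MeasurableSpace α]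
    {μ : Measure Ω} [IsFiniteMeasure μ] {X : Ω → α} {Y : Ω → ℝ} (hX : Measurable X)
    (hY : Measurable Y) (h : IndepFun X Y μ) {φ : α × ℝ → ℝ≥0∞} (hφ : Measurable φ) :
    ∫⁻ ω, φ (X ω, Y ω) ∂μ = ∫⁻ ω, ∫⁻ y, φ (X ω, y) ∂(μ.map Y) ∂μ := by
  have h1 := (indepFun_iff_map_prod_eq_prod_map_map hX.aemeasurable hY.aemeasurable).1 h
  rw [← lintegral_map (f := φ) hφ (hX.prodMk hY), h1, lintegral_prod _ hφ.aemeasurable,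
    lintegral_map hφ.lintegral_prod_right' hX]

lemma partialSum_succ {Ω : Type*} (τ : ℕ → Ω → ℝ) (n : ℕ) (ω : Ω) :
    partialSum τ (n + 1) ω = partialSum τ n ω + τ n ω := Finset.sum_range_succ _ _

namespace IsRenewalSequence

variable {Ω : Type*} [MeasurableSpace Ω] {μ : Measure Ω} [IsProbabilityMeasure μ] {ν : Measure ℝ}
  {τ : ℕ → Ω → ℝ}

section

variable (h : IsRenewalSequence μ ν τ)
include h

lemma isProbabilityMeasure : IsProbabilityMeasure ν := by
  rw [← h.map_eq 0]
  exact Measure.isProbabilityMeasure_map (h.measurable 0).aemeasurable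

lemma measurable_partialSum (n : ℕ) : Measurable (partialSum τ n) :=
  Finset.measurable_sum _ fun i _ => h.measurable i

lemma ae_pos : ∀ᵐ x ∂ν, 0 < x := by
  rw [ae_iff]
  simpa [Set.Iic] using h.pos

lemma ae_pos_seq : ∀ᵐ ω ∂μ, ∀ n, 0 < τ n ω := by
  rw [ae_all_iff]
  intro n
  have := h.ae_pos
  rw [← h.map_eq n] at this
  exact ae_of_ae_map (h.measurable n).aemeasurable this

lemma ae_partialSum_nonneg : ∀ᵐ ω ∂μ, ∀ n, 0 ≤ partialSum τ n ω := by
  filter_upwards [h.ae_pos_seq] with ω hω n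
  exact Finset.sum_nonneg fun i _ => (hω i).le

lemma lintegral_sum_and_next (m : ℕ) {φ : ℝ × ℝ → ℝ≥0∞} (hφ : Measurable φ) :
    ∫⁻ ω, φ (partialSum τ m ω, τ m ω) ∂μ = ∫⁻ ω, ∫⁻ y, φ (partialSum τ m ω, y) ∂ν ∂μ := by
  rw [lintegral_of_indepFun (h.measurable_partialSum m) (h.measurable m) (h.indep_sum m) hφ,
    h.map_eq]

lemma lintegral_pair_and_next {n m : ℕ} (hnm : n < m) {φ : (ℝ × ℝ) × ℝ → ℝ≥0∞}
    (hφ : Measurable φ) :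
    ∫⁻ ω, φ ((τ n ω, partialSum τ m ω), τ m ω) ∂μ
      = ∫⁻ ω, ∫⁻ y, φ ((τ n ω, partialSum τ m ω), y) ∂ν ∂μ := by
  rw [lintegral_of_indepFun ((h.measurable n).prodMk (h.measurable_partialSum m)) (h.measurable m)
    (h.indep_pair n m hnm) hφ, h.map_eq]

/-- The sum up to n + 1 + j splits as S_n, then τ_n, then an independent copy of S_j. Peeling off
the last summand by induction on j needs only the pairwise form of independence in `indep_pair`. -/
lemma lintegral_joint (n j : ℕ) {φ : ℝ × ℝ → ℝ≥0∞} (hφ : Measurable φ) :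
    ∫⁻ ω, φ (τ n ω, partialSum τ (n + 1 + j) ω) ∂μ
      = ∫⁻ s, ∫⁻ x, ∫⁻ s', φ (x, s + x + s') ∂(μ.map (partialSum τ j)) ∂ν
          ∂(μ.map (partialSum τ n)) := by
  have := h.isProbabilityMeasure
  have hprob : ∀ j, IsProbabilityMeasure (μ.map (partialSum τ j)) := fun j =>
    Measure.isProbabilityMeasure_map (h.measurable_partialSum j).aemeasurable
  induction j generalizing φ with
  | zero =>
    have h0 : μ.map (partialSum τ 0) = Measure.dirac 0 := by
      have : partialSum τ 0 = fun _ => 0 := funext fun ω => by simp [partialSum]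
      rw [this, Measure.map_const]; simp
    simp only [h0, add_zero, partialSum_succ]
    rw [h.lintegral_sum_and_next n (φ := fun p => φ (p.2, p.1 + p.2)) (by fun_prop),
      lintegral_map _ (h.measurable_partialSum n)]
    · refine lintegral_congr fun ω => lintegral_congr fun x => ?_
      rw [lintegral_dirac' _ (by fun_prop)]
      simp
    · refine Measurable.lintegral_prod_right' (f := fun p : ℝ × ℝ =>
        ∫⁻ s', φ (p.2, p.1 + p.2 + s') ∂(Measure.dirac 0)) ?_
      exact Measurable.lintegral_prod_right' (f := fun q : (ℝ × ℝ) × ℝ =>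
        φ (q.1.2, q.1.1 + q.1.2 + q.2)) (by fun_prop)
  | succ j ih =>
    have hφ' : Measurable fun p : ℝ × ℝ => ∫⁻ y, φ (p.1, p.2 + y) ∂ν :=
      Measurable.lintegral_prod_right' (f := fun q : (ℝ × ℝ) × ℝ => φ (q.1.1, q.1.2 + q.2))
        (by fun_prop)
    simp only [← add_assoc, partialSum_succ]
    rw [h.lintegral_pair_and_next (by omega)
      (φ := fun q : (ℝ × ℝ) × ℝ => φ (q.1.1, q.1.2 + q.2)) (by fun_prop), ih hφ']
    refine lintegral_congr fun s => lintegral_congr fun x => ?_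
    rw [lintegral_map (by fun_prop) (h.measurable_partialSum _),
      lintegral_map (by fun_prop) (h.measurable_partialSum _)]
    simp only [partialSum_succ]
    rw [h.lintegral_sum_and_next j (φ := fun p => φ (x, s + x + (p.1 + p.2))) (by fun_prop)]
    simp only [add_assoc]

end

instance : SFinite (renewalMeasure μ τ) := by unfold renewalMeasure; infer_instance

section

variable (h : IsRenewalSequence μ ν τ)
include h

lemma lintegral_renewalMeasure {f : ℝ → ℝ≥0∞} (hf : Measurable f) :
    ∫⁻ s, f s ∂(renewalMeasure μ τ) = ∑' n, ∫⁻ ω, f (partialSum τ n ω) ∂μ := by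
  rw [renewalMeasure, lintegral_sum_measure]
  exact tsum_congr fun n => lintegral_map hf (h.measurable_partialSum n)

lemma lconv_renewalMeasure {f : ℝ → ℝ≥0∞} (hf : Measurable f) (t : ℝ) :
    lconv (renewalMeasure μ τ) f t = ∑' n, ∫⁻ ω, f (t - partialSum τ n ω) ∂μ :=
  h.lintegral_renewalMeasure (f := fun s => f (t - s)) (by fun_prop)

lemma renewalMeasure_Iio_zero : renewalMeasure μ τ (Iio 0) = 0 := by
  rw [renewalMeasure, Measure.sum_apply _ measurableSet_Iio, ENNReal.tsum_eq_zero]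
  intro n
  rw [Measure.map_apply (h.measurable_partialSum n) measurableSet_Iio]
  refine measure_mono_null ?_ (ae_iff.1 h.ae_partialSum_nonneg)
  intro ω hω hn
  exact absurd (hn n) (not_le.2 hω)

/-- Chernoff bound: 1{S_n ≤ t} ≤ exp(t - S_n) and E[exp(-S_n)] = aⁿ with a = E[exp(-T)] < 1 by
positivity of T, so a geometric series dominates. -/
lemma renewalMeasure_Iic_ne_top (t : ℝ) : renewalMeasure μ τ (Iic t) ≠ ∞ := by
  have := h.isProbabilityMeasure
  set a : ℝ≥0∞ := ∫⁻ x, ENNReal.ofReal (Real.exp (-x)) ∂ν with ha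
  have ha1 : a < 1 := by
    have hle : a ≤ 1 := by
      calc a ≤ ∫⁻ _, 1 ∂ν := by
            refine lintegral_mono_ae ?_
            filter_upwards [h.ae_pos] with x hx
            rw [ENNReal.ofReal_le_one, Real.exp_le_one_iff]; linarith
        _ = 1 := by simp
    calc a < ∫⁻ _, 1 ∂ν := by
          refine lintegral_strict_mono (IsProbabilityMeasure.ne_zero ν) (by fun_prop)
            (hle.trans_lt ENNReal.one_lt_top).ne ?_
          filter_upwards [h.ae_pos] with x hx
          rw [ENNReal.ofReal_lt_one, Real.exp_lt_one_iff]; linarith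
      _ = 1 := by simp
  have hn : ∀ n, ∫⁻ ω, ENNReal.ofReal (Real.exp (-partialSum τ n ω)) ∂μ = a ^ n := by
    intro n
    induction n with
    | zero => simp [partialSum]
    | succ n ih =>
      simp only [partialSum_succ]
      rw [h.lintegral_sum_and_next n (φ := fun p => ENNReal.ofReal (Real.exp (-(p.1 + p.2))))
        (by fun_prop)]
      have : ∀ s y : ℝ, ENNReal.ofReal (Real.exp (-(s + y)))
          = ENNReal.ofReal (Real.exp (-s)) * ENNReal.ofReal (Real.exp (-y)) := fun s y => by
        rw [← ENNReal.ofReal_mul (Real.exp_pos _).le, ← Real.exp_add]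
        congr 2; ring
      simp only [this]
      have h2 : ∀ ω, ∫⁻ y, ENNReal.ofReal (Real.exp (-partialSum τ n ω))
          * ENNReal.ofReal (Real.exp (-y)) ∂ν
          = ENNReal.ofReal (Real.exp (-partialSum τ n ω)) * a := fun ω =>
        lintegral_const_mul _ (by fun_prop)
      simp only [h2]
      have := h.measurable_partialSum n
      rw [lintegral_mul_const _ (by fun_prop), ih, pow_succ]
  have hbound : renewalMeasure μ τ (Iic t)
      ≤ ∑' n, ENNReal.ofReal (Real.exp t) * a ^ n := by
    rw [← lintegral_indicator_one measurableSet_Iic,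
      h.lintegral_renewalMeasure (by measurability)]
    refine ENNReal.tsum_le_tsum fun n => ?_
    have := h.measurable_partialSum n
    rw [← hn n, ← lintegral_const_mul _ (by fun_prop)]
    refine lintegral_mono fun ω => ?_
    rw [← ENNReal.ofReal_mul (Real.exp_pos _).le, ← Real.exp_add]
    refine indicator_apply_le' (fun hω => ?_) fun _ => zero_le
    rw [Pi.one_apply, ENNReal.one_le_ofReal, Real.one_le_exp_iff]
    have : partialSum τ n ω ≤ t := hω
    linarith
  refine ne_top_of_le_ne_top ?_ hbound
  rw [ENNReal.tsum_mul_left, ENNReal.tsum_geometric]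
  refine ENNReal.mul_ne_top ENNReal.ofReal_ne_top (ENNReal.inv_ne_top.2 ?_)
  have h1 : (0 : ℝ≥0∞) < 1 - a := tsub_pos_iff_lt.2 ha1
  exact h1.ne'

end

end IsRenewalSequence

/-! ### Exact formulas for means of the weighted overshoot -/

lemma tsum_sum_range_eq_tsum_tsum (f : ℕ → ℕ → ℝ≥0∞) :
    ∑' m, ∑ n ∈ Finset.range m, f n m = ∑' n, ∑' j, f n (n + 1 + j) := by
  have h1 : ∀ m, ∑ n ∈ Finset.range m, f n m = ∑' n, if n < m then f n m else 0 := fun m => by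
    rw [tsum_eq_sum (s := Finset.range m) fun n hn => by simp at hn; simp; omega]
    exact Finset.sum_congr rfl fun n hn => by simp [Finset.mem_range.1 hn]
  simp only [h1]
  rw [ENNReal.tsum_comm]
  refine tsum_congr fun n => ?_
  have hinj : Function.Injective fun j => n + 1 + j := fun a b hab => by simpa using hab
  rw [← hinj.tsum_eq (f := fun m => if n < m then f n m else 0)]
  · refine tsum_congr fun j => ?_
    rw [if_pos (by omega)]
  · intro m hm
    simp only [Function.mem_support, ne_eq, ite_eq_right_iff, Classical.not_imp] at hm
    exact ⟨m - (n + 1), by have := hm.1; simp only; omega⟩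

/-- `N` counts the partial sums in `[0, t]`. -/
def IsCountAt {Ω : Type*} [MeasurableSpace Ω] (μ : Measure Ω) (τ : ℕ → Ω → ℝ) (t : ℝ)
    (N : Ω → ℕ) : Prop :=
  ∀ᵐ ω ∂μ, ∀ n, n < N ω ↔ partialSum τ n ω ≤ t

lemma sum_range_eq_tsum_ite {N : ℕ} {s : ℕ → ℝ} {t : ℝ} (hN : ∀ n, n < N ↔ s n ≤ t)
    (g : ℕ → ℝ≥0∞) : ∑ n ∈ Finset.range N, g n = ∑' n, if s n ≤ t then g n else 0 := by
  rw [tsum_eq_sum (s := Finset.range N) fun n hn => by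
    rw [if_neg]; rw [← hN]; simpa using hn]
  exact Finset.sum_congr rfl fun n hn => by rw [if_pos ((hN n).1 (Finset.mem_range.1 hn))]

/-- Only m = N - 1 contributes: for smaller m the next sum is still at most t, and `ENNReal.ofReal`
truncates the negative difference to zero. This replaces the random index N by a series over fixed
indices. -/
lemma mul_overshoot_eq_tsum {N : ℕ} {s : ℕ → ℝ} {t : ℝ} (hN : ∀ n, n < N ↔ s n ≤ t)
    (h0 : s 0 ≤ t) (G : ℕ → ℝ≥0∞) :
    G N * ENNReal.ofReal (s N - t)
      = ∑' m, if s m ≤ t then G (m + 1) * ENNReal.ofReal (s (m + 1) - t) else 0 := by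
  have hN0 : 0 < N := (hN 0).2 h0
  obtain ⟨k, rfl⟩ : ∃ k, N = k + 1 := ⟨N - 1, by omega⟩
  rw [tsum_eq_single k]
  · rw [if_pos ((hN k).1 (by omega))]
  · intro m hm
    split_ifs with hs
    · have h1 := (hN m).2 hs
      have h2 := (hN (m + 1)).1 (by omega)
      rw [ENNReal.ofReal_of_nonpos (by linarith), mul_zero]
    · rfl

namespace IsRenewalSequence

variable {Ω : Type*} [MeasurableSpace Ω] {μ : Measure Ω} [IsProbabilityMeasure μ] {ν : Measure ℝ}
  {τ : ℕ → Ω → ℝ} {N : Ω → ℕ} {t : ℝ} (h : IsRenewalSequence μ ν τ)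
include h

lemma lintegral_weight_mul_excess {w : ℝ → ℝ≥0∞} (hw : Measurable w) (m : ℕ) :
    ∫⁻ ω, (if partialSum τ m ω ≤ t
        then w (τ m ω) * ENNReal.ofReal (partialSum τ (m + 1) ω - t) else 0) ∂μ
      = ∫⁻ ω, excess ν w (t - partialSum τ m ω) ∂μ := by
  simp only [partialSum_succ]
  rw [h.lintegral_sum_and_next m (φ := fun p => if p.1 ≤ t
        then w p.2 * ENNReal.ofReal (p.1 + p.2 - t) else 0)
      (Measurable.ite (measurableSet_le measurable_fst measurable_const) (by fun_prop)
        measurable_const)]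
  refine lintegral_congr fun ω => ?_
  simp only [excess, sub_nonneg]
  split_ifs
  · refine lintegral_congr fun y => ?_
    congr 2; ring
  · simp

/-- Integrating out the straddling interval τ_m leaves the weight of the earlier interval τ_n
untouched; this requires τ_m to be independent of τ_n and S_m jointly. -/
lemma lintegral_earlier_weight_mul_excess {w : ℝ → ℝ≥0∞} (hw : Measurable w) {n m : ℕ}
    (hnm : n < m) :
    ∫⁻ ω, (if partialSum τ m ω ≤ t
        then w (τ n ω) * ENNReal.ofReal (partialSum τ (m + 1) ω - t) else 0) ∂μ
      = ∫⁻ ω, w (τ n ω) * excess ν 1 (t - partialSum τ m ω) ∂μ := by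
  simp only [partialSum_succ]
  rw [h.lintegral_pair_and_next hnm (φ := fun p => if p.1.2 ≤ t
        then w p.1.1 * ENNReal.ofReal (p.1.2 + p.2 - t) else 0)
      (Measurable.ite (measurableSet_le (by fun_prop) measurable_const) (by fun_prop)
        measurable_const)]
  refine lintegral_congr fun ω => ?_
  simp only [excess, sub_nonneg]
  split_ifs
  · rw [← lintegral_const_mul _ (by fun_prop)]
    refine lintegral_congr fun y => ?_
    simp only [Pi.one_apply, one_mul]
    congr 2; ring
  · simp

/-- The mean residual time at `t` is `(U ⋆ k) t` with `k u = E[(T - u)⁺]`. -/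
lemma lintegral_overshoot (ht : 0 ≤ t) (hN : IsCountAt μ τ t N) :
    ∫⁻ ω, ENNReal.ofReal (partialSum τ (N ω) ω - t) ∂μ
      = lconv (renewalMeasure μ τ) (excess ν 1) t := by
  have := h.isProbabilityMeasure
  have hm := h.measurable_partialSum
  rw [h.lconv_renewalMeasure (measurable_excess measurable_one)]
  simp only [← h.lintegral_weight_mul_excess (w := 1) measurable_one]
  rw [← lintegral_tsum fun m => (Measurable.ite (measurableSet_le (hm m) measurable_const)
    (by simp only [Pi.one_apply]; fun_prop) measurable_const).aemeasurable]
  refine lintegral_congr_ae ?_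
  filter_upwards [hN] with ω hω
  have := mul_overshoot_eq_tsum hω (by simpa [partialSum] using ht) 1
  simpa using this

/-- Wald's identity for the partial sum at the first passage beyond `t`. -/
lemma lintegral_first_passage (hN : IsCountAt μ τ t N) :
    ∫⁻ ω, ENNReal.ofReal (partialSum τ (N ω) ω) ∂μ
      = renewalMeasure μ τ (Iic t) * ∫⁻ x, ENNReal.ofReal x ∂ν := by
  have hm := h.measurable_partialSum
  have hτ := h.measurable
  have hU : renewalMeasure μ τ (Iic t) = ∑' n, ∫⁻ ω, (Iic t).indicator 1 (partialSum τ n ω) ∂μ := by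
    rw [← lintegral_indicator_one measurableSet_Iic,
      h.lintegral_renewalMeasure (by measurability)]
  rw [hU, ← ENNReal.tsum_mul_right]
  have h1 : ∀ n, (∫⁻ ω, (Iic t).indicator 1 (partialSum τ n ω) ∂μ) * ∫⁻ x, ENNReal.ofReal x ∂ν
      = ∫⁻ ω, (if partialSum τ n ω ≤ t then ENNReal.ofReal (τ n ω) else 0) ∂μ := fun n => by
    rw [h.lintegral_sum_and_next n (φ := fun p => if p.1 ≤ t then ENNReal.ofReal p.2 else 0)
      (Measurable.ite (measurableSet_le measurable_fst measurable_const) (by fun_prop)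
        measurable_const), ← lintegral_mul_const (f := fun ω => (Iic t).indicator 1
          (partialSum τ n ω)) _ ((measurable_one.indicator measurableSet_Iic).comp (hm n))]
    refine lintegral_congr fun ω => ?_
    by_cases hs : partialSum τ n ω ≤ t <;> simp [hs]
  simp only [h1]
  rw [← lintegral_tsum fun m => (Measurable.ite (measurableSet_le (hm m) measurable_const)
    (by fun_prop) measurable_const).aemeasurable]
  refine lintegral_congr_ae ?_
  filter_upwards [hN, h.ae_pos_seq] with ω hω hpos
  rw [← sum_range_eq_tsum_ite hω, partialSum, ENNReal.ofReal_sum_of_nonneg fun i _ => (hpos i).le]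

/-- The mean of the residual time weighted by `∑ w(T_n)`. -/
lemma lintegral_weights_mul_overshoot (ht : 0 ≤ t) (hN : IsCountAt μ τ t N)
    {w : ℝ → ℝ≥0∞} (hw : Measurable w) :
    ∫⁻ ω, (∑ n ∈ Finset.range (N ω), w (τ n ω))
        * ENNReal.ofReal (partialSum τ (N ω) ω - t) ∂μ
      = lconv (renewalMeasure μ τ) (excess ν w) t
        + ∫⁻ x, w x * lconv (renewalMeasure μ τ)
            (lconv (renewalMeasure μ τ) (excess ν 1)) (t - x) ∂ν := by
  have := h.isProbabilityMeasure
  have hm := h.measurable_partialSum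
  have hτ := h.measurable
  have hk : Measurable (excess ν 1) := measurable_excess measurable_one
  set U := renewalMeasure μ τ with hU
  have hr : Measurable (lconv U (excess ν 1)) := measurable_lconv hk
  have hG : ∀ n m, Measurable fun ω => if partialSum τ m ω ≤ t
      then w (τ n ω) * ENNReal.ofReal (partialSum τ (m + 1) ω - t) else 0 := fun n m =>
    Measurable.ite (measurableSet_le (hm m) measurable_const)
      ((hw.comp (hτ n)).mul (ENNReal.measurable_ofReal.comp ((hm (m + 1)).sub_const t)))
      measurable_const
  -- The index m is that of the interval straddling t. The diagonal n = m will give the first term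
  -- of the formula and n < m the second.
  have h1 : ∫⁻ ω, (∑ n ∈ Finset.range (N ω), w (τ n ω))
        * ENNReal.ofReal (partialSum τ (N ω) ω - t) ∂μ
      = ∑' m, ∑ n ∈ Finset.range (m + 1), ∫⁻ ω, (if partialSum τ m ω ≤ t
          then w (τ n ω) * ENNReal.ofReal (partialSum τ (m + 1) ω - t) else 0) ∂μ := by
    simp only [← lintegral_finsetSum _ fun n _ => hG n _]
    rw [← lintegral_tsum fun m => (Finset.measurable_sum _ fun n _ => hG n m).aemeasurable]
    refine lintegral_congr_ae ?_
    filter_upwards [hN] with ω hω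
    rw [mul_overshoot_eq_tsum hω (by simpa [partialSum] using ht)
      fun m => ∑ n ∈ Finset.range m, w (τ n ω)]
    refine tsum_congr fun m => ?_
    split_ifs
    · rw [Finset.sum_mul]
    · simp
  rw [h1]
  simp only [Finset.sum_range_succ]
  rw [ENNReal.tsum_add, add_comm]
  congr 1
  · simp only [h.lintegral_weight_mul_excess hw]
    exact (h.lconv_renewalMeasure (measurable_excess hw) t).symm
  · have h2 : ∀ m, ∑ n ∈ Finset.range m, ∫⁻ ω, (if partialSum τ m ω ≤ t
          then w (τ n ω) * ENNReal.ofReal (partialSum τ (m + 1) ω - t) else 0) ∂μ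
        = ∑ n ∈ Finset.range m, ∫⁻ ω, w (τ n ω) * excess ν 1 (t - partialSum τ m ω) ∂μ :=
      fun m => Finset.sum_congr rfl fun n hn =>
        h.lintegral_earlier_weight_mul_excess hw (Finset.mem_range.1 hn)
    simp only [h2]
    rw [tsum_sum_range_eq_tsum_tsum fun n m =>
      ∫⁻ ω, w (τ n ω) * excess ν 1 (t - partialSum τ m ω) ∂μ]
    -- With m = n + 1 + j, summing over j and over n each reconstitutes one factor `U` of the double
    -- convolution.
    have h3 : ∀ n j, ∫⁻ ω, w (τ n ω) * excess ν 1 (t - partialSum τ (n + 1 + j) ω) ∂μ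
        = ∫⁻ s, ∫⁻ x, w x * ∫⁻ ω, excess ν 1 (t - s - x - partialSum τ j ω) ∂μ ∂ν
          ∂(μ.map (partialSum τ n)) := fun n j => by
      rw [h.lintegral_joint n j (φ := fun p => w p.1 * excess ν 1 (t - p.2)) (by fun_prop)]
      refine lintegral_congr fun s => lintegral_congr fun x => ?_
      have := hm j
      rw [lintegral_map (by fun_prop) (hm j), ← lintegral_const_mul _ (by fun_prop)]
      simp only [sub_sub, add_assoc]
    simp only [h3]
    have hmeas : ∀ j, Measurable fun p : ℝ × ℝ =>
        w p.2 * ∫⁻ ω, excess ν 1 (t - p.1 - p.2 - partialSum τ j ω) ∂μ := fun j => by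
      have := hm j
      refine Measurable.mul (by fun_prop) ?_
      exact Measurable.lintegral_prod_right' (f := fun q : (ℝ × ℝ) × Ω =>
        excess ν 1 (t - q.1.1 - q.1.2 - partialSum τ j q.2)) (by fun_prop)
    have h4 : ∀ n, ∑' j, ∫⁻ s, ∫⁻ x, w x * ∫⁻ ω, excess ν 1 (t - s - x - partialSum τ j ω) ∂μ ∂ν
          ∂(μ.map (partialSum τ n))
        = ∫⁻ s, ∫⁻ x, w x * lconv U (excess ν 1) (t - s - x) ∂ν ∂(μ.map (partialSum τ n)) :=
      fun n => by
        rw [← lintegral_tsum fun j => (hmeas j).lintegral_prod_right'.aemeasurable]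
        refine lintegral_congr fun s => ?_
        rw [← lintegral_tsum (f := fun j x => w x *
          ∫⁻ ω, excess ν 1 (t - s - x - partialSum τ j ω) ∂μ)
          fun j => ((hmeas j).comp measurable_prodMk_left).aemeasurable]
        refine lintegral_congr fun x => ?_
        rw [ENNReal.tsum_mul_left, h.lconv_renewalMeasure hk]
    simp only [h4]
    rw [← lintegral_sum_measure, ← renewalMeasure, ← hU]
    have hm2 : Measurable fun p : ℝ × ℝ => w p.2 * lconv U (excess ν 1) (t - p.1 - p.2) := by
      fun_prop
    rw [lintegral_lintegral_swap hm2.aemeasurable]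
    refine lintegral_congr fun x => ?_
    rw [lintegral_const_mul _ (by fun_prop), lconv]
    congr 1
    refine lintegral_congr fun s => ?_
    congr 1; ring

/-- The tail function solves `∫ w(x) U(t - x) ν(dx) + (U ⋆ tail) t = E[w] U(t)`. -/
lemma lintegral_weight_mul_add_lconv_tail {w : ℝ → ℝ≥0∞} (hw : Measurable w) :
    ∫⁻ x, w x * renewalMeasure μ τ (Iic (t - x)) ∂ν + lconv (renewalMeasure μ τ) (tail ν w) t
      = (∫⁻ x, w x ∂ν) * renewalMeasure μ τ (Iic t) := by
  have := h.isProbabilityMeasure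
  set U := renewalMeasure μ τ with hU
  have hmI : Measurable fun p : ℝ × ℝ => if p.2 ≤ t - p.1 then w p.1 else 0 :=
    Measurable.ite (measurableSet_le (by fun_prop) (by fun_prop)) (by fun_prop) measurable_const
  have hmJ : Measurable fun p : ℝ × ℝ => if p.2 ≤ t ∧ t - p.2 < p.1 then w p.1 else 0 :=
    Measurable.ite (MeasurableSet.inter (s₁ := {p : ℝ × ℝ | p.2 ≤ t})
      (s₂ := {p : ℝ × ℝ | t - p.2 < p.1}) (measurableSet_le (by fun_prop) (by fun_prop))
      (measurableSet_lt (by fun_prop) (by fun_prop))) (by fun_prop) measurable_const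
  have hconst : ∀ (c : ℝ≥0∞) (b : ℝ), c * U (Iic b) = ∫⁻ s, (if s ≤ b then c else 0) ∂U :=
    fun c b => by
      rw [← lintegral_indicator_const measurableSet_Iic]
      exact lintegral_congr fun s => by simp [indicator_apply]
  have h2 : lconv U (tail ν w) t
      = ∫⁻ x, ∫⁻ s, (if s ≤ t ∧ t - s < x then w x else 0) ∂U ∂ν := by
    rw [lintegral_lintegral_swap (f := fun x s => if s ≤ t ∧ t - s < x then w x else 0)
      hmJ.aemeasurable, lconv]
    refine lintegral_congr fun s => ?_
    by_cases hs : s ≤ t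
    · simp [tail, hs]
    · simp [tail, hs]
  have h3 : (∫⁻ x, w x ∂ν) * U (Iic t) = ∫⁻ x, ∫⁻ s, (if s ≤ t then w x else 0) ∂U ∂ν := by
    rw [← lintegral_mul_const _ hw]
    simp only [hconst]
  rw [h2, h3]
  simp only [hconst]
  rw [← lintegral_add_left (Measurable.lintegral_prod_right' hmI)]
  refine lintegral_congr_ae ?_
  -- For x > 0 the event s ≤ t is the disjoint union of s ≤ t - x and t - x < s ≤ t.
  filter_upwards [h.ae_pos] with x hx
  rw [← lintegral_add_left (f := fun s => if s ≤ t - x then w x else 0)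
    (hmI.comp measurable_prodMk_left)]
  refine lintegral_congr fun s => ?_
  by_cases h1 : s ≤ t - x
  · have h4 : s ≤ t := by linarith
    have h5 : ¬ t - s < x := by linarith
    simp [h1, h4, h5]
  · have h5 : t - s < x := by linarith [not_le.1 h1]
    simp [h1, h5]

end IsRenewalSequence

/-! ### Excess and tail kernels, and their convolutions -/

section Kernels

variable {ν : Measure ℝ} {w : ℝ → ℝ≥0∞}

lemma excess_of_neg {u : ℝ} (hu : u < 0) : excess ν w u = 0 := if_neg (not_le.2 hu)

lemma tail_of_neg {u : ℝ} (hu : u < 0) : tail ν w u = 0 := if_neg (not_le.2 hu)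

lemma excess_antitoneOn : AntitoneOn (excess ν w) (Ici 0) := by
  intro u hu v hv huv
  simp only [excess, if_pos (mem_Ici.1 hu), if_pos (mem_Ici.1 hv)]
  refine lintegral_mono fun x => ?_
  gcongr

lemma tail_antitoneOn : AntitoneOn (tail ν w) (Ici 0) := by
  intro u hu v hv huv
  simp only [tail, if_pos (mem_Ici.1 hu), if_pos (mem_Ici.1 hv)]
  refine lintegral_mono fun x => ?_
  by_cases h : v < x
  · simp [h, lt_of_le_of_lt huv h]
  · simp [h]

lemma excess_le (u : ℝ) : excess ν w u ≤ ∫⁻ x, w x * ENNReal.ofReal x ∂ν := by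
  unfold excess
  split_ifs with hu
  · refine lintegral_mono fun x => ?_
    gcongr
    linarith
  · exact zero_le

lemma tail_le (u : ℝ) : tail ν w u ≤ ∫⁻ x, w x ∂ν := by
  unfold tail
  split_ifs with hu
  · refine lintegral_mono fun x => ?_
    dsimp only
    split_ifs
    · exact le_rfl
    · exact zero_le
  · exact zero_le

lemma lintegral_ofReal_sub {x : ℝ} (hx : 0 < x) :
    ∫⁻ u : ℝ, (if 0 ≤ u then ENNReal.ofReal (x - u) else 0) = ENNReal.ofReal (x ^ 2 / 2) := by
  have h1 : ∀ u : ℝ, (if 0 ≤ u then ENNReal.ofReal (x - u) else 0)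
      = (Icc 0 x).indicator (fun u => ENNReal.ofReal (x - u)) u := fun u => by
    by_cases h0 : 0 ≤ u
    · by_cases h1 : u ≤ x
      · simp [h0, h1]
      · simp [h0, h1, (not_le.1 h1).le]
    · simp [h0]
  simp only [h1]
  rw [lintegral_indicator measurableSet_Icc, ← ofReal_integral_eq_lintegral_ofReal]
  · congr 1
    rw [integral_Icc_eq_integral_Ioc, ← intervalIntegral.integral_of_le hx.le,
      intervalIntegral.integral_sub (by simp) (by simp)]
    simp
    ring
  · exact (continuous_const.sub continuous_id).continuousOn.integrableOn_Icc
  · filter_upwards [ae_restrict_mem measurableSet_Icc] with u hu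
    simpa using hu.2

/-- Tonelli, with the integral of (x - u)⁺ over u ≥ 0 equal to x²/2: this is where the second moment
of T, and the third for the weight x, enters the limit. -/
lemma lintegral_excess [SFinite ν] (hw : Measurable w) (hν : ∀ᵐ x ∂ν, 0 < x) :
    ∫⁻ u, excess ν w u = ∫⁻ x, w x * ENNReal.ofReal (x ^ 2 / 2) ∂ν := by
  have hm : Measurable fun p : ℝ × ℝ =>
      if 0 ≤ p.1 then w p.2 * ENNReal.ofReal (p.2 - p.1) else 0 :=
    Measurable.ite (measurableSet_le (by fun_prop) (by fun_prop)) (by fun_prop) measurable_const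
  have h1 : ∀ u, excess ν w u
      = ∫⁻ x, (if 0 ≤ u then w x * ENNReal.ofReal (x - u) else 0) ∂ν := fun u => by
    by_cases hu : 0 ≤ u <;> simp [excess, hu]
  simp only [h1]
  rw [lintegral_lintegral_swap hm.aemeasurable]
  refine lintegral_congr_ae ?_
  filter_upwards [hν] with x hx
  rw [← lintegral_ofReal_sub hx, ← lintegral_const_mul _
    (Measurable.ite measurableSet_Ici (by fun_prop) measurable_const)]
  exact lintegral_congr fun u => by simp

lemma lintegral_tail [SFinite ν] (hw : Measurable w) :
    ∫⁻ u, tail ν w u = ∫⁻ x, w x * ENNReal.ofReal x ∂ν := by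
  have hm : Measurable fun p : ℝ × ℝ => if 0 ≤ p.1 ∧ p.1 < p.2 then w p.2 else 0 :=
    Measurable.ite (MeasurableSet.inter (s₁ := {p : ℝ × ℝ | 0 ≤ p.1})
      (s₂ := {p : ℝ × ℝ | p.1 < p.2}) (measurableSet_le (by fun_prop) (by fun_prop))
      (measurableSet_lt (by fun_prop) (by fun_prop))) (by fun_prop) measurable_const
  have h1 : ∀ u, tail ν w u = ∫⁻ x, (if 0 ≤ u ∧ u < x then w x else 0) ∂ν := fun u => by
    by_cases hu : 0 ≤ u <;> simp [tail, hu]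
  simp only [h1]
  rw [lintegral_lintegral_swap (f := fun u x => if 0 ≤ u ∧ u < x then w x else 0) hm.aemeasurable]
  refine lintegral_congr fun x => ?_
  have h2 : ∀ u, (if 0 ≤ u ∧ u < x then w x else 0) = (Ico 0 x).indicator (fun _ => w x) u :=
    fun u => by simp [indicator_apply]
  simp only [h2]
  rw [lintegral_indicator_const measurableSet_Ico]
  simp

end Kernels

section Convolution

variable {U : Measure ℝ} {f : ℝ → ℝ≥0∞}

lemma lconv_le_mul {C : ℝ≥0∞} (hneg : ∀ x < 0, f x = 0) (hC : ∀ x, f x ≤ C) (t : ℝ) :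
    lconv U f t ≤ C * U (Iic t) := by
  rw [← lintegral_indicator_const measurableSet_Iic]
  refine lintegral_mono fun s => ?_
  by_cases hs : s ≤ t
  · simpa [hs] using hC _
  · simp [hs, hneg (t - s) (by linarith)]

lemma lconv_of_neg (hU : U (Iio 0) = 0) (hneg : ∀ x < 0, f x = 0) {t : ℝ} (ht : t < 0) :
    lconv U f t = 0 := by
  have h0 : ∀ᵐ s ∂U, 0 ≤ s := by rw [ae_iff]; simpa [Iio] using hU
  rw [lconv, ← lintegral_zero (μ := U)]
  refine lintegral_congr_ae ?_
  filter_upwards [h0] with s hs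
  exact hneg _ (by linarith)

/-- The key renewal theorem for nonincreasing functions on the half-line. -/
lemma tendsto_lconv_of_antitoneOn {lam : ℝ} (hU : IsBlackwell U lam) (hlam : 0 < lam)
    (hf : Measurable f) (hneg : ∀ x < 0, f x = 0) (hanti : AntitoneOn f (Ici 0))
    (hfin : ∀ x, f x ≠ ∞) (hint : ∫⁻ x, f x ≠ ∞) :
    Tendsto (fun t => (lconv U f t).toReal) atTop (𝓝 (lam * (∫⁻ x, f x).toReal)) := by
  have hi : Integrable fun x => (f x).toReal := integrable_toReal_of_lintegral_ne_top
    hf.aemeasurable hint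
  have hs : StepSandwiched fun x => (f x).toReal :=
    stepSandwiched_of_antitoneOn (fun x hx => by simp [hneg x hx]) (fun x => ENNReal.toReal_nonneg)
      (fun x hx y hy hxy => ENNReal.toReal_mono (hfin x) (hanti hx hy hxy)) hi
  have := hs.tendsto_integral hf.ennreal_toReal hU hlam
  rw [integral_toReal hf.aemeasurable (Eventually.of_forall fun x => (hfin x).lt_top)] at this
  convert this using 2 with t
  rw [integral_toReal (f := fun s => f (t - s)) (by fun_prop)
    (Eventually.of_forall fun x => (hfin _).lt_top)]
  rfl

end Convolution

/-! ### Blackwell's theorem from Wald's identity, and limits of weighted means -/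

lemma StepSandwiched.tendsto_zero {g : ℝ → ℝ} (hg : StepSandwiched g) :
    Tendsto g atTop (𝓝 0) := by
  obtain ⟨h, hh, a, ha, hga⟩ := hg.exists_abs_le
  refine squeeze_zero_norm' (a := fun t => a ⌊t / h⌋₊) ?_ ?_
  · filter_upwards [eventually_ge_atTop 0] with t ht
    have := hga t
    rwa [stepFun, if_pos ht] at this
  · exact ha.tendsto_atTop_zero.comp
      (tendsto_nat_floor_atTop.comp (tendsto_id.atTop_div_const hh))

lemma StepSandwiched.exists_bound {g : ℝ → ℝ} (hg : StepSandwiched g) :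
    ∃ B, ∀ t, |g t| ≤ B := by
  obtain ⟨h, hh, a, ha, hga⟩ := hg.exists_abs_le
  refine ⟨∑' n, |a n|, fun t => (hga t).trans ?_⟩
  unfold stepFun
  split_ifs
  · exact (le_abs_self _).trans (ha.abs.le_tsum _ fun n _ => abs_nonneg _)
  · exact tsum_nonneg fun n => abs_nonneg _

/-- A distribution function at bounded distance from `t ↦ λ (t + c)`, with vanishing difference,
satisfies Blackwell's theorem. -/
lemma isBlackwell_of_asymptotics {U : Measure ℝ} {lam c : ℝ} {g : ℝ → ℝ} (hlam : 0 < lam)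
    (hg : StepSandwiched g) (hfin : ∀ t, U (Iic t) ≠ ∞) (hneg : U (Iio 0) = 0)
    (hU : ∀ t, 0 ≤ t → U.real (Iic t) = lam * (t + (c + g t))) : IsBlackwell U lam := by
  have hneg' : ∀ t < 0, U.real (Iic t) = 0 := fun t ht => by
    rw [measureReal_def, measure_mono_null (Iic_subset_Iio.2 ht) hneg, ENNReal.toReal_zero]
  have hIoc : ∀ h, 0 < h → ∀ t, U.real (Ioc (t - h) t) = U.real (Iic t) - U.real (Iic (t - h)) :=
    fun h hh t => by
      have : Ioc (t - h) t = Iic t \ Iic (t - h) := by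
        ext x; simp [and_comm]
      rw [this, measureReal_sdiff (Iic_subset_Iic.2 (by linarith)) measurableSet_Iic
        (hfin _)]
  refine ⟨hfin, fun h hh => ?_, fun h hh => ?_⟩
  · obtain ⟨B, hB⟩ := hg.exists_bound
    have hB0 : 0 ≤ B := (abs_nonneg _).trans (hB 0)
    refine ⟨lam * (h + 2 * |c| + 2 * B), fun t => ?_⟩
    rw [hIoc h hh]
    have h1 := hB t
    have h2 := hB (t - h)
    rw [abs_le] at h1 h2
    have h3 := neg_abs_le c
    have h4 := le_abs_self c
    -- The affine formula holds only on t ≥ 0, whence the cases; when the interval straddles 0 one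
    -- uses t < h.
    rcases lt_or_ge t 0 with ht | ht
    · rw [hneg' t ht, hneg' _ (by linarith)]
      simp only [sub_zero]
      positivity
    · rcases lt_or_ge (t - h) 0 with hth | hth
      · rw [hneg' _ hth, hU t ht, sub_zero]
        refine mul_le_mul_of_nonneg_left ?_ hlam.le
        linarith
      · rw [hU t ht, hU _ hth, ← mul_sub]
        refine mul_le_mul_of_nonneg_left ?_ hlam.le
        linarith
  · have hlim : Tendsto (fun t => lam * (h + (g t - g (t - h)))) atTop
        (𝓝 (lam * (h + (0 - 0)))) := by
      refine Tendsto.const_mul _ (Tendsto.const_add _ (hg.tendsto_zero.sub ?_))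
      exact hg.tendsto_zero.comp (tendsto_atTop_add_const_right _ _ tendsto_id)
    simp only [sub_zero, add_zero] at hlim
    refine hlim.congr' ?_
    filter_upwards [eventually_ge_atTop h] with t ht
    rw [hIoc h hh, hU t (by linarith), hU _ (by linarith)]
    ring

namespace IsRenewalSequence

variable {Ω : Type*} [MeasurableSpace Ω] {μ : Measure Ω} [IsProbabilityMeasure μ] {ν : Measure ℝ}
  {τ : ℕ → Ω → ℝ}

lemma mean_residual_ne_top (h : IsRenewalSequence μ ν τ)
    (hm1 : ∫⁻ x, ENNReal.ofReal x ∂ν ≠ ∞) (t : ℝ) :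
    lconv (renewalMeasure μ τ) (excess ν 1) t ≠ ∞ := by
  refine ne_top_of_le_ne_top ?_ (lconv_le_mul (fun x hx => excess_of_neg hx) excess_le t)
  refine ENNReal.mul_ne_top ?_ (h.renewalMeasure_Iic_ne_top t)
  simpa using hm1

/-- Wald's identity: `U(t) E[T] = t + E[R(t)]`. -/
lemma wald (h : IsRenewalSequence μ ν τ) {t : ℝ} {N : Ω → ℕ} (ht : 0 ≤ t)
    (hN : IsCountAt μ τ t N) :
    renewalMeasure μ τ (Iic t) * ∫⁻ x, ENNReal.ofReal x ∂ν
      = ENNReal.ofReal t + lconv (renewalMeasure μ τ) (excess ν 1) t := by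
  rw [← h.lintegral_first_passage hN, ← h.lintegral_overshoot ht hN]
  have : ENNReal.ofReal t = ∫⁻ _, ENNReal.ofReal t ∂μ := by simp
  rw [this, ← lintegral_add_left measurable_const]
  refine lintegral_congr_ae ?_
  filter_upwards [hN] with ω hω
  have h1 : t < partialSum τ (N ω) ω := by
    have := (hω (N ω)).not.1 (lt_irrefl _)
    exact not_le.1 this
  rw [← ENNReal.ofReal_add ht (by linarith)]
  congr 1; ring

section Asymptotics

variable {g : ℝ → ℝ} {c : ℝ}

/-- Dividing Wald's identity by E[T] turns the expansion c + g of the mean residual time into the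
expansion λ(t + c + g) of `U`. -/
lemma isBlackwell (h : IsRenewalSequence μ ν τ) {N : ℝ → Ω → ℕ}
    (hN : ∀ t, 0 ≤ t → IsCountAt μ τ t (N t))
    (hm1 : ∫⁻ x, ENNReal.ofReal x ∂ν ≠ ∞) (hg : StepSandwiched g)
    (hgr : ∀ t, 0 ≤ t → (lconv (renewalMeasure μ τ) (excess ν 1) t).toReal = c + g t)
    {lam : ℝ} (hlam0 : 0 < lam) (hlam : lam * (∫⁻ x, ENNReal.ofReal x ∂ν).toReal = 1) :
    IsBlackwell (renewalMeasure μ τ) lam := by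
  refine isBlackwell_of_asymptotics (c := c) hlam0 hg h.renewalMeasure_Iic_ne_top
    h.renewalMeasure_Iio_zero fun t ht => ?_
  have hw := congrArg ENNReal.toReal (h.wald ht (hN t ht))
  rw [ENNReal.toReal_mul, ENNReal.toReal_add ENNReal.ofReal_ne_top (h.mean_residual_ne_top hm1 t),
    ENNReal.toReal_ofReal ht, hgr t ht] at hw
  rw [← hw, measureReal_def]
  linear_combination -(renewalMeasure μ τ (Iic t)).toReal * hlam

variable {w : ℝ → ℝ≥0∞} {lam : ℝ}

lemma lconv_mean_residual_ne_top (h : IsRenewalSequence μ ν τ)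
    (hm1 : ∫⁻ x, ENNReal.ofReal x ∂ν ≠ ∞) (hg : StepSandwiched g)
    (hgr : ∀ t, 0 ≤ t → (lconv (renewalMeasure μ τ) (excess ν 1) t).toReal = c + g t) :
    ∃ C : ℝ≥0, ∀ t, lconv (renewalMeasure μ τ) (lconv (renewalMeasure μ τ) (excess ν 1)) t
      ≤ C * renewalMeasure μ τ (Iic t) := by
  obtain ⟨B, hB⟩ := hg.exists_bound
  have hB0 : 0 ≤ B := (abs_nonneg _).trans (hB 0)
  have hneg : ∀ x < 0, lconv (renewalMeasure μ τ) (excess ν 1) x = 0 := fun x hx =>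
    lconv_of_neg h.renewalMeasure_Iio_zero (fun x hx => excess_of_neg hx) hx
  refine ⟨Real.toNNReal (|c| + B), fun t => lconv_le_mul hneg (fun x => ?_) t⟩
  rcases lt_or_ge x 0 with hx | hx
  · rw [hneg x hx]; exact zero_le
  · rw [← ENNReal.ofReal_toReal (h.mean_residual_ne_top hm1 x), hgr x hx]
    exact ENNReal.ofReal_le_ofReal (by linarith [le_abs_self c, (abs_le.1 (hB x)).2])

lemma lintegral_weight_mul_ne_top (h : IsRenewalSequence μ ν τ)
    (hm1 : ∫⁻ x, ENNReal.ofReal x ∂ν ≠ ∞) (hw : Measurable w) (hw0 : ∫⁻ x, w x ∂ν ≠ ∞)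
    (hg : StepSandwiched g)
    (hgr : ∀ t, 0 ≤ t → (lconv (renewalMeasure μ τ) (excess ν 1) t).toReal = c + g t) (t : ℝ) :
    ∫⁻ x, w x * lconv (renewalMeasure μ τ)
      (lconv (renewalMeasure μ τ) (excess ν 1)) (t - x) ∂ν ≠ ∞ := by
  obtain ⟨C, hC⟩ := h.lconv_mean_residual_ne_top hm1 hg hgr
  have h1 : ∫⁻ x, w x * lconv (renewalMeasure μ τ)
      (lconv (renewalMeasure μ τ) (excess ν 1)) (t - x) ∂ν
      ≤ ∫⁻ x, w x * (C * renewalMeasure μ τ (Iic t)) ∂ν := by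
    refine lintegral_mono_ae ?_
    filter_upwards [h.ae_pos] with x hx
    refine mul_le_mul_right ((hC _).trans (mul_le_mul_right (measure_mono ?_) _)) _
    exact Iic_subset_Iic.2 (by linarith)
  refine ne_top_of_le_ne_top ?_ h1
  rw [lintegral_mul_const _ hw]
  exact ENNReal.mul_ne_top hw0 (ENNReal.mul_ne_top ENNReal.coe_ne_top
    (h.renewalMeasure_Iic_ne_top t))

/-- The mean residual time is c + g on the half-line and zero before it, so its convolution splits
into a convergent part and c times the divergent U[0,t]. -/
lemma toReal_lconv_mean_residual (h : IsRenewalSequence μ ν τ)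
    (hm1 : ∫⁻ x, ENNReal.ofReal x ∂ν ≠ ∞) (hg : StepSandwiched g) (hgm : Measurable g)
    (hgneg : ∀ t < 0, g t = 0)
    (hgr : ∀ t, 0 ≤ t → (lconv (renewalMeasure μ τ) (excess ν 1) t).toReal = c + g t)
    (hU : IsBlackwell (renewalMeasure μ τ) lam) (t : ℝ) :
    (lconv (renewalMeasure μ τ) (lconv (renewalMeasure μ τ) (excess ν 1)) t).toReal
      = (∫ s, g (t - s) ∂(renewalMeasure μ τ)) + c * (renewalMeasure μ τ (Iic t)).toReal := by
  have := h.isProbabilityMeasure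
  set U := renewalMeasure μ τ with hUdef
  have hr : Measurable (lconv U (excess ν 1)) := measurable_lconv (measurable_excess measurable_one)
  have h0 : (lconv U (lconv U (excess ν 1)) t).toReal
      = ∫ s, (lconv U (excess ν 1) (t - s)).toReal ∂U :=
    (integral_toReal (f := fun s => lconv U (excess ν 1) (t - s)) (by fun_prop)
      (Eventually.of_forall fun s => (h.mean_residual_ne_top hm1 _).lt_top)).symm
  rw [h0]
  have h1 : ∀ s, (lconv U (excess ν 1) (t - s)).toReal
      = g (t - s) + (Iic t).indicator (fun _ => c) s := fun s => by
    by_cases hs : s ≤ t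
    · rw [hgr _ (by linarith), indicator_of_mem (mem_Iic.2 hs), add_comm]
    · rw [hUdef, lconv_of_neg h.renewalMeasure_Iio_zero (fun x hx => excess_of_neg hx)
        (by linarith), hgneg _ (by linarith), indicator_of_notMem (by simpa using hs)]
      simp
  simp only [h1]
  have hI : Integrable ((Iic t).indicator fun _ : ℝ => c) U :=
    (integrable_indicator_iff measurableSet_Iic).2 (integrableOn_const (hU.finite t))
  rw [integral_add (hg.integrable hgm hU t) hI, integral_indicator measurableSet_Iic]
  simp [measureReal_def, mul_comm]

/-- Asymptotics of `E[R(t) ∑ w(T_n)]`. -/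
lemma tendsto_weights (h : IsRenewalSequence μ ν τ)
    (hm1 : ∫⁻ x, ENNReal.ofReal x ∂ν ≠ ∞) (hg : StepSandwiched g) (hgm : Measurable g)
    (hgneg : ∀ t < 0, g t = 0)
    (hgr : ∀ t, 0 ≤ t → (lconv (renewalMeasure μ τ) (excess ν 1) t).toReal = c + g t)
    (hlam0 : 0 < lam) (hU : IsBlackwell (renewalMeasure μ τ) lam)
    (hw : Measurable w) (hwfin : ∀ x, w x ≠ ∞) (hw0 : ∫⁻ x, w x ∂ν ≠ ∞)
    (hw1 : ∫⁻ x, w x * ENNReal.ofReal x ∂ν ≠ ∞)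
    (hw2 : ∫⁻ x, w x * ENNReal.ofReal (x ^ 2 / 2) ∂ν ≠ ∞) :
    Tendsto (fun t => (lconv (renewalMeasure μ τ) (excess ν w) t
        + ∫⁻ x, w x * lconv (renewalMeasure μ τ)
            (lconv (renewalMeasure μ τ) (excess ν 1)) (t - x) ∂ν).toReal
        - c * (∫⁻ x, w x ∂ν).toReal * (renewalMeasure μ τ (Iic t)).toReal) atTop
      (𝓝 (lam * (∫⁻ x, w x * ENNReal.ofReal (x ^ 2 / 2) ∂ν).toReal
        + (∫⁻ x, w x ∂ν).toReal * (lam * ∫ x, g x)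
        - c * (lam * (∫⁻ x, w x * ENNReal.ofReal x ∂ν).toReal))) := by
  have := h.isProbabilityMeasure
  set U := renewalMeasure μ τ with hUdef
  have hr : Measurable (lconv U (excess ν 1)) := measurable_lconv (measurable_excess measurable_one)
  have hQ : Measurable (lconv U (lconv U (excess ν 1))) := measurable_lconv hr
  have hefin : ∀ x, excess ν w x ≠ ∞ := fun x => ne_top_of_le_ne_top hw1 (excess_le x)
  have htfin : ∀ x, tail ν w x ≠ ∞ := fun x => ne_top_of_le_ne_top hw0 (tail_le x)
  have hE : Tendsto (fun t => (lconv U (excess ν w) t).toReal) atTop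
      (𝓝 (lam * (∫⁻ x, w x * ENNReal.ofReal (x ^ 2 / 2) ∂ν).toReal)) := by
    rw [← lintegral_excess hw h.ae_pos]
    exact tendsto_lconv_of_antitoneOn hU hlam0 (measurable_excess hw)
      (fun x hx => excess_of_neg hx) excess_antitoneOn hefin
      (by rw [lintegral_excess hw h.ae_pos]; exact hw2)
  have hP : Tendsto (fun t => (lconv U (tail ν w) t).toReal) atTop
      (𝓝 (lam * (∫⁻ x, w x * ENNReal.ofReal x ∂ν).toReal)) := by
    rw [← lintegral_tail hw]
    exact tendsto_lconv_of_antitoneOn hU hlam0 (measurable_tail hw)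
      (fun x hx => tail_of_neg hx) tail_antitoneOn htfin
      (by rw [lintegral_tail hw]; exact hw1)
  set V : ℝ → ℝ := fun t => ∫ s, g (t - s) ∂U with hV
  obtain ⟨B, hB⟩ := hg.bound_integral hgm hU
  have hVlim : Tendsto V atTop (𝓝 (lam * ∫ x, g x)) := hg.tendsto_integral hgm hU hlam0
  have hVm : Measurable V := by
    have : StronglyMeasurable fun p : ℝ × ℝ => g (p.1 - p.2) :=
      (hgm.comp (measurable_fst.sub measurable_snd)).stronglyMeasurable
    exact this.integral_prod_right'.measurable
  have hwi : Integrable (fun x => (w x).toReal) ν :=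
    integrable_toReal_of_lintegral_ne_top hw.aemeasurable hw0
  have hwV : ∀ t, Integrable (fun x => (w x).toReal * V (t - x)) ν := fun t =>
    hwi.mul_bdd (c := B) (hVm.comp (by fun_prop)).aestronglyMeasurable
      (Eventually.of_forall fun x => hB _)
  -- Dominated convergence with `w` times the uniform bound `B` on `V`.
  have hΦ : Tendsto (fun t => ∫ x, (w x).toReal * V (t - x) ∂ν) atTop
      (𝓝 ((∫⁻ x, w x ∂ν).toReal * (lam * ∫ x, g x))) := by
    rw [← integral_toReal hw.aemeasurable (Eventually.of_forall fun x => (hwfin x).lt_top),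
      ← integral_mul_const]
    refine tendsto_integral_filter_of_dominated_convergence (fun x => (w x).toReal * B)
      (Eventually.of_forall fun t => (hwV t).1) (Eventually.of_forall fun t =>
        Eventually.of_forall fun x => ?_) (hwi.mul_const B) (Eventually.of_forall fun x => ?_)
    · rw [norm_mul, Real.norm_of_nonneg ENNReal.toReal_nonneg]
      exact mul_le_mul_of_nonneg_left (hB _) ENNReal.toReal_nonneg
    · refine Tendsto.const_mul _ (hVlim.comp ?_)
      exact tendsto_atTop_add_const_right _ _ tendsto_id
  refine ((hE.add hΦ).sub (hP.const_mul c)).congr' (Eventually.of_forall fun t => ?_)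
  have hEfin : lconv U (excess ν w) t ≠ ∞ := ne_top_of_le_ne_top
    (ENNReal.mul_ne_top hw1 (h.renewalMeasure_Iic_ne_top t))
    (lconv_le_mul (fun x hx => excess_of_neg hx) excess_le t)
  have hPfin : lconv U (tail ν w) t ≠ ∞ := ne_top_of_le_ne_top
    (ENNReal.mul_ne_top hw0 (h.renewalMeasure_Iic_ne_top t))
    (lconv_le_mul (fun x hx => tail_of_neg hx) tail_le t)
  have hQfin : ∫⁻ x, w x * lconv U (lconv U (excess ν 1)) (t - x) ∂ν ≠ ∞ :=
    h.lintegral_weight_mul_ne_top hm1 hw hw0 hg hgr t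
  have hQt : ∀ x, lconv U (lconv U (excess ν 1)) x ≠ ∞ := fun x => by
    obtain ⟨C, hC⟩ := h.lconv_mean_residual_ne_top hm1 hg hgr
    exact ne_top_of_le_ne_top (ENNReal.mul_ne_top ENNReal.coe_ne_top
      (h.renewalMeasure_Iic_ne_top x)) (hC x)
  -- This trades the shifted masses U[0,t-x] for E[w] U[0,t], the compensator in the statement, at
  -- the cost of the convolution with the tail, whose limit is `hP`.
  have htot := h.lintegral_weight_mul_add_lconv_tail (t := t) hw
  rw [← hUdef] at htot
  have hUfin : ∫⁻ x, w x * U (Iic (t - x)) ∂ν ≠ ∞ := by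
    refine ne_top_of_le_ne_top (ENNReal.mul_ne_top hw0 (h.renewalMeasure_Iic_ne_top t)) ?_
    rw [← hUdef, ← htot]
    exact le_self_add
  have hUm : Measurable fun x => U (Iic (t - x)) := by
    have hanti : Antitone fun x => U (Iic (t - x)) := fun x y hxy =>
      measure_mono (Iic_subset_Iic.2 (by linarith))
    exact hanti.measurable
  have htot' := congrArg ENNReal.toReal htot
  rw [ENNReal.toReal_add hUfin hPfin, ENNReal.toReal_mul] at htot'
  have hsplit : (∫⁻ x, w x * lconv U (lconv U (excess ν 1)) (t - x) ∂ν).toReal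
      = (∫ x, (w x).toReal * V (t - x) ∂ν) + c * (∫⁻ x, w x * U (Iic (t - x)) ∂ν).toReal := by
    have hUt := h.renewalMeasure_Iic_ne_top
    have hVt := h.toReal_lconv_mean_residual hm1 hg hgm hgneg hgr hU
    rw [← hUdef] at hUt hVt
    clear_value U
    have e1 : (∫⁻ x, w x * lconv U (lconv U (excess ν 1)) (t - x) ∂ν).toReal
        = ∫ x, (w x * lconv U (lconv U (excess ν 1)) (t - x)).toReal ∂ν :=
      (integral_toReal (hw.mul (hQ.comp (measurable_const.sub measurable_id))).aemeasurable
        (Eventually.of_forall fun x => (ENNReal.mul_ne_top (hwfin x) (hQt _)).lt_top)).symm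
    have e2 : (∫⁻ x, w x * U (Iic (t - x)) ∂ν).toReal
        = ∫ x, (w x * U (Iic (t - x))).toReal ∂ν :=
      (integral_toReal (hw.mul hUm).aemeasurable
        (Eventually.of_forall fun x => (ENNReal.mul_ne_top (hwfin x) (hUt _)).lt_top)).symm
    have hi2 : Integrable (fun x => c * (w x * U (Iic (t - x))).toReal) ν :=
      (integrable_toReal_of_lintegral_ne_top (hw.mul hUm).aemeasurable hUfin).const_mul c
    rw [e1, e2, ← integral_const_mul, ← integral_add (hwV t) hi2]
    refine integral_congr_ae (Eventually.of_forall fun x => ?_)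
    simp only [ENNReal.toReal_mul, hVt, hV]
    ring
  beta_reduce
  rw [ENNReal.toReal_add hEfin hQfin, hsplit]
  linear_combination (-c) * htot'

end Asymptotics

end IsRenewalSequence

/-! ### Counting times of an orderly process -/

section Paths

variable {Ω : Type*} {N : ℝ≥0 → Ω → ℕ}

/-- An integer-valued right-continuous path is constant just after t, so the infimum cannot be t
unless the level is already reached there. -/
lemma countingTime_le_iff (hN : IsOrderlyCounting N) {n : ℕ} {ω : Ω} {t : ℝ≥0} :
    countingTime N n ω ≤ t ↔ n + 1 ≤ N t ω := by
  refine ⟨fun h => ?_, fun h => iInf₂_le t h⟩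
  by_contra hlt
  have hev : ∀ᶠ s in 𝓝[≥] t, N s ω = N t ω :=
    (hN.rightCts ω t).eventually (p := fun k => k = N t ω) (by simp)
  obtain ⟨u, hu, hsub⟩ := (mem_nhdsGE_iff_exists_Ico_subset' (lt_add_one t)).1 hev
  have hge : (u : ℝ≥0∞) ≤ countingTime N n ω := by
    refine le_iInf₂ fun s hs => ENNReal.coe_le_coe.2 (not_lt.1 fun hsu => hlt ?_)
    rcases le_total s t with hst | hst
    · exact hs.trans (hN.mono ω hst)
    · have : N s ω = N t ω := hsub ⟨hst, hsu⟩
      omega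
  exact absurd (hge.trans h) (not_le.2 (ENNReal.coe_lt_coe.2 hu))

/-- If two counting times coincided at t, the left limit would be at most n while N(t) ≥ n + 2,
against unit jumps; at t = 0 `jump_zero` plays this role. -/
lemma countingTime_lt_succ (hN : IsOrderlyCounting N) {n : ℕ} {ω : Ω}
    (hfin : countingTime N n ω ≠ ∞) : countingTime N n ω < countingTime N (n + 1) ω := by
  obtain ⟨t, ht⟩ := WithTop.ne_top_iff_exists.1 hfin
  change (t : ℝ≥0∞) = _ at ht
  rw [← ht]
  by_contra hle
  have h2 := (countingTime_le_iff hN).1 (not_lt.1 hle)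
  rcases eq_or_ne t 0 with rfl | h0
  · have := hN.jump_zero ω; omega
  · obtain ⟨l, hl, hjump⟩ := hN.jump ω t (pos_iff_ne_zero.2 h0)
    have hlt : ∀ᶠ s in 𝓝[<] t, N s ω ≤ n := by
      filter_upwards [self_mem_nhdsWithin] with s hs
      by_contra hs2
      have h3 : countingTime N n ω ≤ s := (countingTime_le_iff hN).2 (by omega)
      rw [← ht] at h3
      exact absurd (ENNReal.coe_le_coe.1 h3) (not_le.2 hs)
    have : (𝓝[<] t).NeBot := nhdsLT_neBot_of_exists_lt ⟨0, pos_iff_ne_zero.2 h0⟩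
    have hln : l ≤ n := le_of_tendsto hl hlt
    omega

lemma countingTime_mono : Monotone fun n => countingTime N n := by
  refine monotone_nat_of_le_succ fun n ω => ?_
  exact le_iInf₂ fun s hs => iInf₂_le s (by omega)

lemma countingTime_lt_of_lt (hN : IsOrderlyCounting N) {n m : ℕ} (hnm : n < m) {ω : Ω}
    (hfin : countingTime N n ω ≠ ∞) : countingTime N n ω < countingTime N m ω :=
  (countingTime_lt_succ hN hfin).trans_le (countingTime_mono (by omega) ω)

variable [mΩ : MeasurableSpace Ω] {F : Filtration ℝ≥0 mΩ}

lemma measurable_stateProcess (hF : ∀ t, stateSigma N t ≤ F t) (t : ℝ≥0) :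
    Measurable[F t] (stateProcess N t) := by
  rw [measurable_iff_comap_le]
  exact (le_iSup₂_of_le (f := fun u (_ : u ≤ t) =>
    MeasurableSpace.comap (stateProcess N u) inferInstance) t le_rfl le_rfl).trans (hF t)

lemma measurable_count (hF : ∀ t, stateSigma N t ≤ F t) (t : ℝ≥0) : Measurable[F t] (N t) :=
  measurable_fst.comp (measurable_stateProcess hF t)

lemma measurable_residual (hF : ∀ t, stateSigma N t ≤ F t) (t : ℝ≥0) :
    Measurable (residual N t) :=
  (measurable_snd.comp (measurable_stateProcess hF t)).mono (F.le t) le_rfl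

lemma measurable_countingTime (hN : IsOrderlyCounting N) (hF : ∀ t, stateSigma N t ≤ F t) (n : ℕ) :
    Measurable (countingTime N n) := by
  refine measurable_of_Iic fun x => ?_
  induction x using ENNReal.recTopCoe with
  | top => simp
  | coe t =>
    have : countingTime N n ⁻¹' Iic (t : ℝ≥0∞) = N t ⁻¹' Ici (n + 1) := by
      ext ω
      exact countingTime_le_iff hN
    rw [this]
    exact F.le t _ (measurable_count hF t measurableSet_Ici)

/-- For n < m the strict inequality t_n < t_m leaves room for a rational: {t_n < x} is the union
over q < x of {t_n ≤ q < t_m}, each a generator. For n = m the sets {t < t_m} are generators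
themselves. -/
lemma measurable_countingTime_strictPast (hN : IsOrderlyCounting N)
    (hF : ∀ t, stateSigma N t ≤ F t) {n m : ℕ} (hnm : n ≤ m) :
    Measurable[strictPast F (countingTime N m)] (countingTime N n) := by
  have hgen : ∀ (t : ℝ≥0) (A : Set Ω), MeasurableSet[F t] A →
      MeasurableSet[strictPast F (countingTime N m)]
        (A ∩ {ω | (t : ℝ≥0∞) < countingTime N m ω}) := fun t A hA =>
    MeasurableSpace.measurableSet_generateFrom ⟨t, A, hA, rfl⟩
  rcases hnm.eq_or_lt with rfl | hlt
  · refine measurable_of_Ioi fun x => ?_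
    induction x using ENNReal.recTopCoe with
    | top => simp
    | coe t =>
      have := hgen t univ (@MeasurableSet.univ _ (F t))
      rwa [univ_inter] at this
  · refine measurable_of_Iio fun x => ?_
    have heq : countingTime N n ⁻¹' Iio x = ⋃ q : {q : ℚ // ((Real.toNNReal q : ℝ≥0) : ℝ≥0∞) < x},
        (N (Real.toNNReal q) ⁻¹' Ici (n + 1)
          ∩ {ω | ((Real.toNNReal q : ℝ≥0) : ℝ≥0∞) < countingTime N m ω}) := by
      ext ω
      simp only [mem_preimage, mem_Iio, mem_iUnion, mem_inter_iff, mem_Ici, mem_ofPred_eq]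
      constructor
      · intro hx
        have h1 := lt_min hx (countingTime_lt_of_lt hN hlt (hx.trans_le le_top).ne)
        obtain ⟨q, -, hq1, hq2⟩ := ENNReal.lt_iff_exists_rat_btwn.1 h1
        exact ⟨⟨q, hq2.trans_le (min_le_left _ _)⟩, (countingTime_le_iff hN).1 hq1.le,
          hq2.trans_le (min_le_right _ _)⟩
      · rintro ⟨⟨q, hq⟩, h1, -⟩
        exact ((countingTime_le_iff hN).2 h1).trans_lt hq
    rw [heq]
    exact MeasurableSet.iUnion fun q => hgen _ _ (measurable_count hF _ measurableSet_Ici)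

end Paths

/-! ### The lifetimes form a renewal sequence -/

section Sequence

variable {Ω : Type*} [mΩ : MeasurableSpace Ω] {μ : Measure Ω} [IsProbabilityMeasure μ]
  {F : Filtration ℝ≥0 mΩ} {N : ℝ≥0 → Ω → ℕ}

/-- The lifetimes `T_1, T_2, …` as real random variables, indexed from zero. -/
noncomputable def lifetimes (N : ℝ≥0 → Ω → ℕ) (n : ℕ) (ω : Ω) : ℝ :=
  (interTime N (n + 1) ω).toReal

lemma measurable_interTime_succ (hN : IsOrderlyCounting N) (hF : ∀ t, stateSigma N t ≤ F t)
    (n : ℕ) : Measurable (interTime N (n + 1)) :=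
  (measurable_countingTime hN hF (n + 1)).sub (measurable_countingTime hN hF n)

lemma measurable_lifetimes (hN : IsOrderlyCounting N) (hF : ∀ t, stateSigma N t ≤ F t) (n : ℕ) :
    Measurable (lifetimes N n) :=
  (measurable_interTime_succ hN hF n).ennreal_toReal

lemma measurable_lifetimes_strictPast (hN : IsOrderlyCounting N)
    (hF : ∀ t, stateSigma N t ≤ F t) {n m : ℕ} (hnm : n < m) :
    Measurable[strictPast F (countingTime N m)] (lifetimes N n) := by
  have h1 := measurable_countingTime_strictPast hN hF (n := n + 1) (m := m) hnm
  have h2 := measurable_countingTime_strictPast hN hF (n := n) (m := m) hnm.le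
  exact (h1.sub h2).ennreal_toReal

lemma measurable_partialSum_lifetimes_strictPast (hN : IsOrderlyCounting N)
    (hF : ∀ t, stateSigma N t ≤ F t) (m : ℕ) :
    Measurable[strictPast F (countingTime N m)] (partialSum (lifetimes N) m) := by
  unfold partialSum
  exact Finset.measurable_sum _ fun i hi =>
    measurable_lifetimes_strictPast hN hF (Finset.mem_range.1 hi)

/-- Almost surely, every counting time is finite and equals the sum of the preceding lifetimes. -/
lemma ae_countingTime_eq (hA1 : StartsAtZero μ N) (hA2 : FiniteMeans μ N)
    (hN : IsOrderlyCounting N) (hF : ∀ t, stateSigma N t ≤ F t) :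
    ∀ᵐ ω ∂μ, ∀ n, interTime N (n + 1) ω ≠ ∞ ∧ 0 ≤ partialSum (lifetimes N) n ω ∧
      countingTime N n ω = ENNReal.ofReal (partialSum (lifetimes N) n ω) := by
  have hfin : ∀ᵐ ω ∂μ, ∀ n, interTime N (n + 1) ω < ∞ := by
    rw [ae_all_iff]
    exact fun n => ae_lt_top (measurable_interTime_succ hN hF n) (hA2 (n + 1) (by omega)).ne
  filter_upwards [hA1, hfin] with ω h1 h2 n
  refine ⟨(h2 n).ne, Finset.sum_nonneg fun i _ => ENNReal.toReal_nonneg, ?_⟩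
  induction n with
  | zero =>
    have h3 : N 0 ω = 1 := congrArg Prod.fst h1
    have h4 : countingTime N 0 ω ≤ (0 : ℝ≥0) := (countingTime_le_iff hN).2 (by omega)
    simpa [partialSum] using h4
  | succ n ih =>
    have h3 : countingTime N n ω ≤ countingTime N (n + 1) ω := countingTime_mono (by omega) ω
    rw [partialSum_succ, ENNReal.ofReal_add (p := partialSum (lifetimes N) n ω)
      (q := lifetimes N n ω) (Finset.sum_nonneg fun i _ => ENNReal.toReal_nonneg) ENNReal.toReal_nonneg, ← ih,
      lifetimes, ENNReal.ofReal_toReal (h2 n).ne]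
    exact (add_tsub_cancel_of_le h3).symm

lemma isCountAt_lifetimes (hA1 : StartsAtZero μ N) (hA2 : FiniteMeans μ N)
    (hN : IsOrderlyCounting N) (hF : ∀ t, stateSigma N t ≤ F t) (t : ℝ≥0) :
    IsCountAt μ (lifetimes N) t (N t) := by
  filter_upwards [ae_countingTime_eq hA1 hA2 hN hF] with ω hω n
  rw [← Nat.succ_le_iff, Nat.succ_eq_add_one, ← countingTime_le_iff hN, (hω n).2.2,
    ← ENNReal.ofReal_coe_nnreal, ENNReal.ofReal_le_ofReal_iff t.coe_nonneg]

/-- Earlier lifetimes are determined strictly before the counting time t_m, so (A.3) makes the next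
lifetime independent of them and of their sum. Positivity comes from the strict increase of counting
times. -/
lemma isRenewalSequence_lifetimes (hA1 : StartsAtZero μ N) (hA2 : FiniteMeans μ N)
    (hA3 : RenewalCondition μ F N) (hN : IsOrderlyCounting N) (hF : ∀ t, stateSigma N t ≤ F t) :
    IsRenewalSequence μ (μ.map (lifetime N)) (lifetimes N) where
  measurable := measurable_lifetimes hN hF
  map_eq n := ((hA3.identDistrib (n + 1) (by omega)).comp ENNReal.measurable_toReal).map_eq
  pos := by
    have hm : Measurable (lifetime N) := measurable_lifetimes hN hF 0
    rw [Measure.map_apply hm measurableSet_Iic]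
    have : ∀ᵐ ω ∂μ, 0 < lifetimes N 0 ω := by
      filter_upwards [ae_countingTime_eq hA1 hA2 hN hF] with ω hω
      have h0 : countingTime N 0 ω ≠ ∞ := by rw [(hω 0).2.2]; exact ENNReal.ofReal_ne_top
      exact ENNReal.toReal_pos (tsub_pos_iff_lt.2 (countingTime_lt_succ hN h0)).ne' (hω 0).1
    rw [ae_iff] at this
    refine measure_mono_null (fun ω hω => ?_) this
    exact not_lt.2 hω
  indep_sum m := by
    have h1 := measurable_iff_comap_le.1 (measurable_partialSum_lifetimes_strictPast hN hF m)
    have h2 : MeasurableSpace.comap (lifetimes N m) inferInstance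
        ≤ MeasurableSpace.comap (interTime N (m + 1)) inferInstance :=
      measurable_iff_comap_le.1 (ENNReal.measurable_toReal.comp (comap_measurable _))
    exact indep_of_indep_of_le_left (indep_of_indep_of_le_right (hA3.indep m).symm h2) h1
  indep_pair n m hnm := by
    have h1 := measurable_iff_comap_le.1 ((measurable_lifetimes_strictPast hN hF hnm).prodMk
      (measurable_partialSum_lifetimes_strictPast hN hF m))
    have h2 : MeasurableSpace.comap (lifetimes N m) inferInstance
        ≤ MeasurableSpace.comap (interTime N (m + 1)) inferInstance :=
      measurable_iff_comap_le.1 (ENNReal.measurable_toReal.comp (comap_measurable _))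
    exact indep_of_indep_of_le_left (indep_of_indep_of_le_right (hA3.indep m).symm h2) h1

lemma sum_Icc_one_eq_sum_range {M : Type*} [AddCommMonoid M] (f : ℕ → M) (n : ℕ) :
    ∑ l ∈ Finset.Icc 1 n, f l = ∑ i ∈ Finset.range n, f (i + 1) := by
  induction n with
  | zero => simp
  | succ n ih => rw [Finset.sum_Icc_succ_top (by omega), Finset.sum_range_succ, ih]

lemma ae_residual_eq (hA1 : StartsAtZero μ N) (hA2 : FiniteMeans μ N)
    (hN : IsOrderlyCounting N) (hF : ∀ t, stateSigma N t ≤ F t) (t : ℝ≥0) :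
    ∀ᵐ ω ∂μ, residual N t ω = partialSum (lifetimes N) (N t ω) ω - t := by
  filter_upwards [ae_countingTime_eq hA1 hA2 hN hF] with ω hω
  have h0 : interTime N 0 ω = 0 := by
    have : countingTime N 0 ω = 0 := by simpa [partialSum] using (hω 0).2.2
    exact this
  rw [residual, h0, zero_add, sum_Icc_one_eq_sum_range, ENNReal.toReal_sum fun i _ => (hω i).1]
  rfl

lemma ae_residual_nonneg (hA1 : StartsAtZero μ N) (hA2 : FiniteMeans μ N)
    (hN : IsOrderlyCounting N) (hF : ∀ t, stateSigma N t ≤ F t) (t : ℝ≥0) :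
    ∀ᵐ ω ∂μ, 0 ≤ residual N t ω := by
  filter_upwards [ae_residual_eq hA1 hA2 hN hF t, isCountAt_lifetimes hA1 hA2 hN hF t]
    with ω h1 h2
  have := (h2 (N t ω)).not.1 (lt_irrefl _)
  rw [h1]
  linarith

/-- The lifetimes up to the first passage beyond t add up to R(t) + t. -/
lemma ae_renewalMartingale_eq (hA1 : StartsAtZero μ N) (hA2 : FiniteMeans μ N)
    (hN : IsOrderlyCounting N) (hF : ∀ t, stateSigma N t ≤ F t) (t : ℝ≥0) :
    ∀ᵐ ω ∂μ, renewalMartingale μ N t ω = N t ω - rate μ N * (residual N t ω + t) := by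
  filter_upwards [ae_residual_eq hA1 hA2 hN hF t] with ω h1
  rw [h1, renewalMartingale, sum_Icc_one_eq_sum_range, Finset.sum_sub_distrib, ← Finset.mul_sum]
  simp [partialSum, lifetimes]

/-- The cellwise infima and suprema are the two step functions; a mesh with gap below ε exists by
the limit condition. -/
lemma stepSandwiched_of_directlyRiemannIntegrable {f : ℝ≥0 → ℝ} {g : ℝ → ℝ}
    (hf : DirectlyRiemannIntegrable f) (hfg : ∀ t : ℝ≥0, g t = f t) (hg : ∀ t < 0, g t = 0) :
    StepSandwiched g := by
  intro ε hε
  have h1 := hf.tendsto.eventually (gt_mem_nhds hε)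
  obtain ⟨h, hlt, hh⟩ := (h1.and self_mem_nhdsWithin).exists
  have hh0 : (0 : ℝ) < h := NNReal.coe_pos.2 hh
  have hmem : ∀ t : ℝ≥0, t ∈ cell h ⌊(t : ℝ) / h⌋₊ := fun t => by
    have := (mem_Ico_iff_floor hh0 _ (t : ℝ)).2 ⟨t.2, rfl⟩
    exact ⟨by exact_mod_cast this.1, by exact_mod_cast this.2⟩
  refine ⟨h, hh0, _, _, hf.summable_sup h hh, hf.summable_inf h hh, fun x => ?_, fun x => ?_, hlt⟩
  · rcases lt_or_ge x 0 with hx | hx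
    · rw [stepFun, if_neg (not_le.2 hx), hg x hx]
    · lift x to ℝ≥0 using hx
      rw [stepFun, if_pos x.coe_nonneg, hfg]
      exact csInf_le (hf.bddBelow h hh _) (mem_image_of_mem f (hmem x))
  · rcases lt_or_ge x 0 with hx | hx
    · rw [stepFun, if_neg (not_le.2 hx), hg x hx]
    · lift x to ℝ≥0 using hx
      rw [stepFun, if_pos x.coe_nonneg, hfg]
      exact le_csSup (hf.bddAbove h hh _) (mem_image_of_mem f (hmem x))

end Sequence

/-! ### Moments of the lifetime and cancellation in the difference -/

section Moments

variable {ν : Measure ℝ} [IsProbabilityMeasure ν]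

lemma integrable_pow_of_cube (hpos : ∀ᵐ x ∂ν, 0 < x)
    (h3 : ∫⁻ x, ENNReal.ofReal (x ^ 3) ∂ν ≠ ∞) {k : ℕ} (hk : k ≤ 3) :
    Integrable (fun x => x ^ k) ν := by
  have hc : Integrable (fun x => x ^ 3) ν :=
    (lintegral_ofReal_ne_top_iff_integrable (by fun_prop)
      (hpos.mono fun x hx => by positivity)).1 h3
  refine ((integrable_const (1 : ℝ)).add hc).mono' (by fun_prop) ?_
  filter_upwards [hpos] with x hx
  rw [Real.norm_of_nonneg (by positivity), Pi.add_apply]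
  rcases le_total x 1 with h1 | h1
  · linarith [pow_le_one₀ (n := k) hx.le h1, pow_pos hx 3]
  · linarith [pow_le_pow_right₀ h1 hk]

omit [IsProbabilityMeasure ν] in
lemma lintegral_eq_ofReal_moment (hpos : ∀ᵐ x ∂ν, 0 < x) {k : ℕ} {q : ℝ} (hq : 0 ≤ q)
    (hi : Integrable (fun x => x ^ k) ν) {f : ℝ → ℝ≥0∞}
    (hf : ∀ x, 0 < x → f x = ENNReal.ofReal (q * x ^ k)) :
    ∫⁻ x, f x ∂ν = ENNReal.ofReal (q * ∫ x, x ^ k ∂ν) := by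
  rw [← integral_const_mul, ofReal_integral_eq_lintegral_ofReal (hi.const_mul q)
    (hpos.mono fun x hx => by have := hx.le; simp only [Pi.zero_apply]; positivity)]
  exact lintegral_congr_ae (hpos.mono hf)

end Moments

/-- Limit of the mean of `R(t) M(t)`, written as a difference of weighted means. -/
lemma IsRenewalSequence.tendsto_weights_sub {Ω : Type*} [MeasurableSpace Ω] {μ : Measure Ω}
    [IsProbabilityMeasure μ] {ν : Measure ℝ} {τ : ℕ → Ω → ℝ} {g : ℝ → ℝ} {c lam : ℝ}
    (h : IsRenewalSequence μ ν τ)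
    (h3 : ∫⁻ x, ENNReal.ofReal (x ^ 3) ∂ν ≠ ∞) (hg : StepSandwiched g) (hgm : Measurable g)
    (hgneg : ∀ t < 0, g t = 0)
    (hgr : ∀ t, 0 ≤ t → (lconv (renewalMeasure μ τ) (excess ν 1) t).toReal = c + g t)
    (hlam0 : 0 < lam) (hlam : lam * ∫ x, x ^ 1 ∂ν = 1)
    (hU : IsBlackwell (renewalMeasure μ τ) lam) :
    Tendsto (fun t => (lconv (renewalMeasure μ τ) (excess ν 1) t
        + ∫⁻ x, 1 * lconv (renewalMeasure μ τ)
            (lconv (renewalMeasure μ τ) (excess ν 1)) (t - x) ∂ν).toReal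
        - lam * (lconv (renewalMeasure μ τ) (excess ν ENNReal.ofReal) t
        + ∫⁻ x, ENNReal.ofReal x * lconv (renewalMeasure μ τ)
            (lconv (renewalMeasure μ τ) (excess ν 1)) (t - x) ∂ν).toReal) atTop
      (𝓝 (lam * (1 / 2 * ∫ x, x ^ 2 ∂ν) - lam ^ 2 * (1 / 2 * ∫ x, x ^ 3 ∂ν)
        + c * (lam ^ 2 * (∫ x, x ^ 2 ∂ν) - 1))) := by
  have := h.isProbabilityMeasure
  have hpos := h.ae_pos
  have hi : ∀ {k : ℕ}, k ≤ 3 → Integrable (fun x : ℝ => x ^ k) ν := fun hk =>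
    integrable_pow_of_cube hpos h3 hk
  have hm0 : ∀ k : ℕ, 0 ≤ ∫ x, x ^ k ∂ν := fun k =>
    integral_nonneg_of_ae (hpos.mono fun x hx => by
      have := hx.le; simp only [Pi.zero_apply]; positivity)
  have a0 : ∫⁻ x, (1 : ℝ → ℝ≥0∞) x ∂ν = 1 := by simp
  have a1 : ∫⁻ x, (1 : ℝ → ℝ≥0∞) x * ENNReal.ofReal x ∂ν = ENNReal.ofReal (1 * ∫ x, x ^ 1 ∂ν) :=
    lintegral_eq_ofReal_moment hpos zero_le_one (hi (by norm_num)) fun x hx => by simp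
  have a2 : ∫⁻ x, (1 : ℝ → ℝ≥0∞) x * ENNReal.ofReal (x ^ 2 / 2) ∂ν
      = ENNReal.ofReal (1 / 2 * ∫ x, x ^ 2 ∂ν) :=
    lintegral_eq_ofReal_moment hpos (by norm_num) (hi (by norm_num)) fun x hx => by
      rw [Pi.one_apply, one_mul]; congr 1; ring
  have b0 : ∫⁻ x, ENNReal.ofReal x ∂ν = ENNReal.ofReal (1 * ∫ x, x ^ 1 ∂ν) :=
    lintegral_eq_ofReal_moment hpos zero_le_one (hi (by norm_num)) fun x hx => by simp
  have b1 : ∫⁻ x, ENNReal.ofReal x * ENNReal.ofReal x ∂ν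
      = ENNReal.ofReal (1 * ∫ x, x ^ 2 ∂ν) :=
    lintegral_eq_ofReal_moment hpos zero_le_one (hi (by norm_num)) fun x hx => by
      rw [← ENNReal.ofReal_mul hx.le]; congr 1; ring
  have b2 : ∫⁻ x, ENNReal.ofReal x * ENNReal.ofReal (x ^ 2 / 2) ∂ν
      = ENNReal.ofReal (1 / 2 * ∫ x, x ^ 3 ∂ν) :=
    lintegral_eq_ofReal_moment hpos (by norm_num) (hi (by norm_num)) fun x hx => by
      rw [← ENNReal.ofReal_mul hx.le]; congr 1; ring
  have hm1 : ∫⁻ x, ENNReal.ofReal x ∂ν ≠ ∞ := by rw [b0]; exact ENNReal.ofReal_ne_top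
  have hA := h.tendsto_weights hm1 hg hgm hgneg hgr hlam0 hU (w := 1) measurable_one (by simp)
    (by rw [a0]; exact ENNReal.one_ne_top) (by rw [a1]; exact ENNReal.ofReal_ne_top)
    (by rw [a2]; exact ENNReal.ofReal_ne_top)
  have hB := h.tendsto_weights hm1 hg hgm hgneg hgr hlam0 hU (w := ENNReal.ofReal)
    ENNReal.measurable_ofReal (by simp) hm1 (by rw [b1]; exact ENNReal.ofReal_ne_top)
    (by rw [b2]; exact ENNReal.ofReal_ne_top)
  rw [a0, a1, a2, ENNReal.toReal_ofReal (mul_nonneg (by norm_num) (hm0 _)),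
    ENNReal.toReal_ofReal (mul_nonneg (by norm_num) (hm0 _))] at hA
  rw [b0, b1, b2, ENNReal.toReal_ofReal (mul_nonneg (by norm_num) (hm0 _)),
    ENNReal.toReal_ofReal (mul_nonneg (by norm_num) (hm0 _)),
    ENNReal.toReal_ofReal (mul_nonneg (by norm_num) (hm0 _))] at hB
  have hAB := hA.sub (hB.const_mul lam)
  refine (hAB.congr fun t => ?_).trans (le_of_eq ?_)
  · simp only [ENNReal.toReal_one, Pi.one_apply]
    -- The compensators for w = 1 and w(x) = x are c U[0,t] and c E[T] U[0,t]; they cancel since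
    -- λE[T] = 1.
    linear_combination c * (renewalMeasure μ τ (Iic t)).toReal * hlam
  · congr 1
    simp only [ENNReal.toReal_one]
    -- The integral of `g` carries the factor 1 - λE[T] = 0, so its value is never needed.
    linear_combination (-(lam * ∫ x, g x) - c) * hlam

/-! ### Integrability and mean of R(t)M(t) -/

section Means

variable {Ω : Type*} [mΩ : MeasurableSpace Ω] {μ : Measure Ω} [IsProbabilityMeasure μ]
  {F : Filtration ℝ≥0 mΩ} {N : ℝ≥0 → Ω → ℕ}

/-- The means of `R(t) N(t)` and of `R(t) ∑ T_n` as Lebesgue integrals determine that of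
`R(t) M(t)`. -/
lemma integral_residual_mul_renewalMartingale (hA1 : StartsAtZero μ N) (hA2 : FiniteMeans μ N)
    (hN : IsOrderlyCounting N) (hF : ∀ t, stateSigma N t ≤ F t) (t : ℝ≥0)
    (h1 : ∫⁻ ω, (∑ _n ∈ Finset.range (N t ω), (1 : ℝ≥0∞))
        * ENNReal.ofReal (partialSum (lifetimes N) (N t ω) ω - t) ∂μ ≠ ∞)
    (h2 : ∫⁻ ω, (∑ n ∈ Finset.range (N t ω), ENNReal.ofReal (lifetimes N n ω))
        * ENNReal.ofReal (partialSum (lifetimes N) (N t ω) ω - t) ∂μ ≠ ∞) :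
    Integrable (fun ω => residual N t ω * renewalMartingale μ N t ω) μ ∧
    ∫ ω, residual N t ω * renewalMartingale μ N t ω ∂μ
      = (∫⁻ ω, (∑ _n ∈ Finset.range (N t ω), (1 : ℝ≥0∞))
          * ENNReal.ofReal (partialSum (lifetimes N) (N t ω) ω - t) ∂μ).toReal
        - rate μ N * (∫⁻ ω, (∑ n ∈ Finset.range (N t ω), ENNReal.ofReal (lifetimes N n ω))
          * ENNReal.ofReal (partialSum (lifetimes N) (N t ω) ω - t) ∂μ).toReal := by
  have hR := measurable_residual hF t
  have hNm : Measurable fun ω => (N t ω : ℝ) :=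
    measurable_from_top.comp ((measurable_count hF t).mono (F.le t) le_rfl)
  have hres := ae_residual_eq hA1 hA2 hN hF t
  have hres0 := ae_residual_nonneg hA1 hA2 hN hF t
  have e1 : ∫⁻ ω, (∑ _n ∈ Finset.range (N t ω), (1 : ℝ≥0∞))
        * ENNReal.ofReal (partialSum (lifetimes N) (N t ω) ω - t) ∂μ
      = ∫⁻ ω, ENNReal.ofReal (N t ω * residual N t ω) ∂μ := by
    refine lintegral_congr_ae ?_
    filter_upwards [hres] with ω hω
    rw [hω, ENNReal.ofReal_mul (Nat.cast_nonneg _)]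
    simp
  -- Here the weights sum to R(t) + t.
  have e2 : ∫⁻ ω, (∑ n ∈ Finset.range (N t ω), ENNReal.ofReal (lifetimes N n ω))
        * ENNReal.ofReal (partialSum (lifetimes N) (N t ω) ω - t) ∂μ
      = ∫⁻ ω, ENNReal.ofReal ((residual N t ω + t) * residual N t ω) ∂μ := by
    refine lintegral_congr_ae ?_
    filter_upwards [hres, hres0] with ω hω h0
    rw [ENNReal.ofReal_mul (add_nonneg h0 t.coe_nonneg), hω, sub_add_cancel, partialSum,
      ENNReal.ofReal_sum_of_nonneg (f := fun i => lifetimes N i ω)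
        fun i _ => ENNReal.toReal_nonneg]
  rw [e1] at h1 ⊢
  rw [e2] at h2 ⊢
  have n1 : 0 ≤ᵐ[μ] fun ω => N t ω * residual N t ω := by
    filter_upwards [hres0] with ω h0
    exact mul_nonneg (Nat.cast_nonneg _) h0
  have n2 : 0 ≤ᵐ[μ] fun ω => (residual N t ω + t) * residual N t ω := by
    filter_upwards [hres0] with ω h0
    exact mul_nonneg (add_nonneg h0 t.coe_nonneg) h0
  have m1 : AEStronglyMeasurable (fun ω => N t ω * residual N t ω) μ :=
    (hNm.mul hR).aestronglyMeasurable
  have m2 : AEStronglyMeasurable (fun ω => (residual N t ω + t) * residual N t ω) μ :=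
    ((hR.add_const _).mul hR).aestronglyMeasurable
  have i1 := (lintegral_ofReal_ne_top_iff_integrable m1 n1).1 h1
  have i2 := (lintegral_ofReal_ne_top_iff_integrable m2 n2).1 h2
  have heq : (fun ω => residual N t ω * renewalMartingale μ N t ω) =ᵐ[μ] fun ω =>
      N t ω * residual N t ω - rate μ N * ((residual N t ω + t) * residual N t ω) := by
    filter_upwards [ae_renewalMartingale_eq hA1 hA2 hN hF t] with ω hω
    rw [hω]; ring
  refine ⟨(i1.sub (i2.const_mul _)).congr heq.symm, ?_⟩
  rw [integral_congr_ae heq, integral_sub i1 (i2.const_mul _), integral_const_mul,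
    integral_eq_lintegral_of_nonneg_ae n1 m1, integral_eq_lintegral_of_nonneg_ae n2 m2]

end Means

end Renewal

/-! ### The limit theorem -/

theorem lemma4p1 {Ω : Type*} [mΩ : MeasurableSpace Ω] (μ : Measure Ω) [IsProbabilityMeasure μ]
    (F : Filtration ℝ≥0 mΩ) (N : ℝ≥0 → Ω → ℕ)
    (hN : Renewal.IsOrderlyCounting N)
    (hF : ∀ t, Renewal.stateSigma N t ≤ F t)
    (hA1 : Renewal.StartsAtZero μ N)
    (hA2 : Renewal.FiniteMeans μ N)
    (hA3 : Renewal.RenewalCondition μ F N)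
    (h4a : Renewal.DirectlyRiemannIntegrable fun t =>
      (∫ ω, Renewal.residual N t ω ∂μ)
        - 1 / 2 * Renewal.rate μ N * ∫ ω, Renewal.lifetime N ω ^ 2 ∂μ)
    (hT3 : ∫⁻ ω, Renewal.interTime N 1 ω ^ 3 ∂μ < ∞) :
    (∀ t, Integrable (fun ω => Renewal.residual N t ω * Renewal.renewalMartingale μ N t ω) μ) ∧
    Tendsto (fun t : ℝ≥0 =>
        ∫ ω, Renewal.residual N t ω * Renewal.renewalMartingale μ N t ω ∂μ) atTop
      (𝓝 (1 / 2 * (Renewal.rate μ N * (∫ ω, Renewal.lifetime N ω ^ 2 ∂μ)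
            - Renewal.rate μ N ^ 2 * ∫ ω, Renewal.lifetime N ω ^ 3 ∂μ)
          + 1 / 2 * Renewal.rate μ N ^ 3 * variance (Renewal.lifetime N) μ
            * ∫ ω, Renewal.lifetime N ω ^ 2 ∂μ)) := by
  open Renewal in
  have hτm : Measurable (lifetime N) := measurable_lifetimes hN hF 0
  set ν := μ.map (lifetime N) with hν
  set τ := lifetimes N with hτ
  have h : IsRenewalSequence μ ν τ := isRenewalSequence_lifetimes hA1 hA2 hA3 hN hF
  have := h.isProbabilityMeasure
  have hpos := h.ae_pos
  have h3 : ∫⁻ x, ENNReal.ofReal (x ^ 3) ∂ν ≠ ∞ := by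
    rw [hν, lintegral_map (by fun_prop) hτm]
    refine ne_top_of_le_ne_top hT3.ne (lintegral_mono fun ω => ?_)
    rw [lifetime, ENNReal.ofReal_pow ENNReal.toReal_nonneg]
    exact pow_le_pow_left₀ zero_le ENNReal.ofReal_toReal_le 3
  have hmom : ∀ k : ℕ, ∫ x, x ^ k ∂ν = ∫ ω, lifetime N ω ^ k ∂μ := fun k =>
    integral_map hτm.aemeasurable (by fun_prop)
  have hi : ∀ {k : ℕ}, k ≤ 3 → Integrable (fun x : ℝ => x ^ k) ν := fun hk =>
    integrable_pow_of_cube hpos h3 hk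
  have hm1 : ∫⁻ x, ENNReal.ofReal x ∂ν = ENNReal.ofReal (1 * ∫ x, x ^ 1 ∂ν) :=
    lintegral_eq_ofReal_moment hpos zero_le_one (hi (by norm_num)) fun x hx => by simp
  have hm1fin : ∫⁻ x, ENNReal.ofReal x ∂ν ≠ ∞ := by rw [hm1]; exact ENNReal.ofReal_ne_top
  have hmean : 0 < ∫ x, x ^ 1 ∂ν := by
    rw [integral_pos_iff_support_of_nonneg_ae
      (hpos.mono fun x hx => by simp only [Pi.zero_apply, pow_one]; exact hx.le) (hi (by norm_num))]
    have hsupp : ∀ᵐ x ∂ν, x ∈ Function.support fun x : ℝ => x ^ 1 :=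
      hpos.mono fun x hx => by simp [hx.ne']
    have heq : (Function.support fun x : ℝ => x ^ 1) =ᵐ[ν] univ := eventuallyEq_univ.2 hsupp
    rw [measure_congr heq]
    simp
  set lam := rate μ N with hlamdef
  have hlameq : lam = 1 / ∫ x, x ^ 1 ∂ν := by
    rw [hlamdef, rate, hmom]; simp
  have hlam : lam * ∫ x, x ^ 1 ∂ν = 1 := by rw [hlameq, one_div, inv_mul_cancel₀ hmean.ne']
  have hlam0 : 0 < lam := by rw [hlameq]; positivity
  set c := 1 / 2 * lam * ∫ ω, lifetime N ω ^ 2 ∂μ with hc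
  have hcount := isCountAt_lifetimes hA1 hA2 hN hF
  set r := lconv (renewalMeasure μ τ) (excess ν 1) with hr
  -- This is the function in (4a), extended by zero, since the mean residual time equals `r` by
  -- `lintegral_overshoot`.
  set g : ℝ → ℝ := fun t => if 0 ≤ t then (r t).toReal - c else 0 with hg
  have hgm : Measurable g := Measurable.ite measurableSet_Ici
    ((measurable_lconv (measurable_excess measurable_one)).ennreal_toReal.sub_const c)
    measurable_const
  have hgneg : ∀ t < 0, g t = 0 := fun t ht => if_neg (not_le.2 ht)
  have hgr : ∀ t, 0 ≤ t → (r t).toReal = c + g t := fun t ht => by simp [hg, ht]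
  have hres : ∀ t : ℝ≥0, ∫ ω, Renewal.residual N t ω ∂μ = (r t).toReal := fun t => by
    rw [integral_eq_lintegral_of_nonneg_ae (ae_residual_nonneg hA1 hA2 hN hF t)
      (measurable_residual hF t).aestronglyMeasurable, hr,
      ← h.lintegral_overshoot t.coe_nonneg (hcount t)]
    congr 1
    refine lintegral_congr_ae ?_
    filter_upwards [ae_residual_eq hA1 hA2 hN hF t] with ω hω
    rw [hω]
  have hgs : StepSandwiched g := stepSandwiched_of_directlyRiemannIntegrable h4a
    (fun t => by simp [hg, hres]) hgneg
  have hU : IsBlackwell (renewalMeasure μ τ) lam := by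
    refine h.isBlackwell (N := fun t => N t.toNNReal) (fun t ht => ?_) hm1fin hgs hgr hlam0 ?_
    · have := hcount t.toNNReal
      rwa [Real.coe_toNNReal t ht] at this
    · rw [hm1, one_mul, ENNReal.toReal_ofReal hmean.le, hlam]
  have hlim := h.tendsto_weights_sub h3 hgs hgm hgneg hgr hlam0 hlam hU
  have hw1 := fun t : ℝ≥0 => h.lintegral_weights_mul_overshoot t.coe_nonneg (hcount t)
    (w := 1) measurable_one
  have hwx := fun t : ℝ≥0 => h.lintegral_weights_mul_overshoot t.coe_nonneg (hcount t)
    (w := ENNReal.ofReal) ENNReal.measurable_ofReal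
  have hm2fin : ∫⁻ x, ENNReal.ofReal x * ENNReal.ofReal x ∂ν ≠ ∞ := by
    rw [lintegral_eq_ofReal_moment hpos zero_le_one (k := 2) (hi (by norm_num)) fun x hx => by
      rw [← ENNReal.ofReal_mul hx.le]; congr 1; ring]
    exact ENNReal.ofReal_ne_top
  have hfin1 : ∀ t : ℝ≥0, lconv (renewalMeasure μ τ) (excess ν 1) t
      + ∫⁻ x, (1 : ℝ → ℝ≥0∞) x * lconv (renewalMeasure μ τ) r (t - x) ∂ν ≠ ∞ := fun t =>
    ENNReal.add_ne_top.2 ⟨h.mean_residual_ne_top hm1fin t,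
      h.lintegral_weight_mul_ne_top hm1fin measurable_one (by simp) hgs hgr t⟩
  have hfinx : ∀ t : ℝ≥0, lconv (renewalMeasure μ τ) (excess ν ENNReal.ofReal) t
      + ∫⁻ x, ENNReal.ofReal x * lconv (renewalMeasure μ τ) r (t - x) ∂ν ≠ ∞ := fun t =>
    ENNReal.add_ne_top.2 ⟨ne_top_of_le_ne_top
      (ENNReal.mul_ne_top hm2fin (h.renewalMeasure_Iic_ne_top t))
      (lconv_le_mul (fun x hx => excess_of_neg hx) excess_le t),
      h.lintegral_weight_mul_ne_top hm1fin ENNReal.measurable_ofReal hm1fin hgs hgr t⟩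
  have key := fun t : ℝ≥0 => integral_residual_mul_renewalMartingale hA1 hA2 hN hF t
    (by have := hfin1 t; rw [← hw1 t] at this; exact this)
    (by have := hfinx t; rw [← hwx t] at this; exact this)
  refine ⟨fun t => (key t).1, ?_⟩
  have hvar : variance (lifetime N) μ = ∫ x, x ^ 2 ∂ν - (∫ x, x ^ 1 ∂ν) ^ 2 := by
    have hsq : Integrable (fun ω => lifetime N ω ^ 2) μ :=
      (integrable_map_measure (f := lifetime N) (g := fun x : ℝ => x ^ 2) (by fun_prop)
        hτm.aemeasurable).1 (hi (by norm_num))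
    rw [variance_eq_sub ((memLp_two_iff_integrable_sq hτm.aestronglyMeasurable).2 hsq), hmom, hmom]
    simp
  have hlim' := hlim.comp (NNReal.tendsto_coe_atTop.2 tendsto_id)
  refine (hlim'.congr fun t => ?_).trans (le_of_eq ?_)
  · rw [(key t).2]
    have e1 := hw1 t
    have e2 := hwx t
    simp only [Pi.one_apply] at e1
    rw [e1, e2]
    rfl
  · congr 1
    rw [hvar, hc, ← hmom, ← hmom]
    -- Here c(λ²E[T²] - 1) = cλ²σ_T², by factoring λ²E[T]² - 1 = (λE[T] + 1)(λE[T] - 1).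
    linear_combination (1 / 2 * lam * (∫ x, x ^ 2 ∂ν)) * (lam * (∫ x, x ^ 1 ∂ν) + 1) * hlam
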